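/- A \emph{literal} is a propositional variable or its negation; a \emph{clause} is a finite set of literals, read as their disjunction; a \emph{CNF formula} is a finite set of clauses, read as their conjunction. A CNF formula is a \emph{Krom formula} (2-CNF formula) if each of its clauses contains at most two literals. The \emph{implication problem for Krom formulas}, $\mathrm{IMP}(\mathrm{Krom})$, is the following decision problem: given (encoded as a word over a finite alphabet) a finite set $\Phi$ of Krom formulas and a Krom formula $\psi$, decide whether $\Phi \models \psi$, that is, whether every truth assignment that satisfies all formulas in $\Phi$ also satisfies $\psi$. \textbf{Lemma.} $\mathrm{IMP}(\mathrm{Krom}) \in \mathrm{P}$; that is, the set of encodings of the pairs $(\Phi,\psi)$ of this form with $\Phi \models \psi$ is decided by a deterministic Turing machine in time polynomial in the length of the input word. -/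

import Mathlib

namespace KromImp

/-! ### Propositional logic: CNF formulas as finite sets of clauses -/

/-- Propositional variables, identified with their names; names are binary words, so there is a
countably infinite supply of variables. -/
abbrev PVar := List Bool

/-- A literal is a variable (`positive = true`) or a negated variable (`positive = false`). -/
structure Literal where
  var : PVar
  positive : Bool
deriving DecidableEq

/-- A clause is a finite set of literals, read as their disjunction. -/
abbrev Clause := Finset Literal

/-- A CNF formula is a finite set of clauses, read as their conjunction. -/
abbrev CNF := Finset Clause

/-- A truth assignment. Only the values on the variables that occur in a formula matter. -/
abbrev Assignment := PVar → Bool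

/-- The truth value of a literal. -/
def Literal.eval (θ : Assignment) (ℓ : Literal) : Bool :=
  if ℓ.positive then θ ℓ.var else !(θ ℓ.var)

/-- `θ` satisfies at least one literal of the clause (so the empty clause is false). -/
def Clause.SatisfiedBy (C : Clause) (θ : Assignment) : Prop :=
  ∃ ℓ ∈ C, ℓ.eval θ = true

/-- `θ` satisfies every clause of the formula (so the empty formula is true). -/
def CNF.SatisfiedBy (φ : CNF) (θ : Assignment) : Prop :=
  ∀ C ∈ φ, Clause.SatisfiedBy C θ

/-- `Φ ⊨ ψ`: every assignment that satisfies all formulas of `Φ` satisfies `ψ`. -/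
def Entails (Φ : Finset CNF) (ψ : CNF) : Prop :=
  ∀ θ : Assignment, (∀ φ ∈ Φ, CNF.SatisfiedBy φ θ) → CNF.SatisfiedBy ψ θ

/-- The class of Krom (2-CNF) formulas: every clause contains at most two literals. -/
def krom : Set CNF := {φ | ∀ C ∈ φ, C.card ≤ 2}

/-! ### Encoding of instances as words over a finite alphabet -/

/-- The input alphabet. -/
inductive Symbol
  | bit (b : Bool)
  | pos
  | neg
  | endClause
  | endFormula
  | turnstile
deriving DecidableEq, Fintype

/-- A literal is written as the name of its variable followed by its sign. -/
def encodeLiteral (ℓ : Literal) : List Symbol :=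
  ℓ.var.map Symbol.bit ++ [if ℓ.positive then Symbol.pos else Symbol.neg]

/-- A clause is written by listing its literals, followed by an end marker. -/
def encodeClause (c : List Literal) : List Symbol :=
  c.flatMap encodeLiteral ++ [Symbol.endClause]

/-- A formula is written by listing its clauses, followed by an end marker. -/
def encodeFormula (f : List (List Literal)) : List Symbol :=
  f.flatMap encodeClause ++ [Symbol.endFormula]

/-- An instance is written by listing the premises, then a turnstile, then the conclusion. -/
def encodeInstance (p : List (List (List Literal))) (f : List (List Literal)) : List Symbol :=
  p.flatMap encodeFormula ++ [Symbol.turnstile] ++ encodeFormula f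

/-- The CNF formula whose clauses, and their literals, are enumerated by the list `f`
(in any order, possibly with repetitions). -/
def toCNF (f : List (List Literal)) : CNF :=
  (f.map List.toFinset).toFinset

/-- The set of CNF formulas enumerated by the list `p`. -/
def toPremises (p : List (List (List Literal))) : Finset CNF :=
  (p.map toCNF).toFinset

/-- The word `w` is an encoding of the instance `(Φ, ψ)`. -/
def IsEncoding (w : List Symbol) (Φ : Finset CNF) (ψ : CNF) : Prop :=
  ∃ p f, toPremises p = Φ ∧ toCNF f = ψ ∧ encodeInstance p f = w

/-- The implication problem for a class `F` of CNF formulas, as a formal language: the encodings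
of all pairs `(Φ, ψ)` with `Φ` a finite set of formulas from `F`, `ψ ∈ F`, and `Φ ⊨ ψ`. -/
def IMP (F : Set CNF) : Language Symbol :=
  {w | ∃ (Φ : Finset CNF) (ψ : CNF), IsEncoding w Φ ψ ∧ (Φ : Set CNF) ⊆ F ∧ ψ ∈ F ∧ Entails Φ ψ}

/-! ### The encoding is uniquely readable -/

theorem flatMap_end_inj {α : Type} (e : α → List Symbol) (t : Symbol)
    (he : ∀ a b r s, e a ++ r = e b ++ s → a = b ∧ r = s)
    (ht : ∀ a r s, e a ++ r ≠ t :: s) :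
    ∀ (l m : List α) (r s : List Symbol),
      l.flatMap e ++ [t] ++ r = m.flatMap e ++ [t] ++ s → l = m ∧ r = s := by
  intro l
  induction l with
  | nil =>
    intro m r s h
    cases m with
    | nil => simpa using h
    | cons b m =>
      simp only [List.flatMap_nil, List.flatMap_cons, List.nil_append, List.append_assoc,
        List.cons_append] at h
      exact absurd h.symm (ht _ _ _)
  | cons a l ih =>
    intro m r s h
    cases m with
    | nil =>
      simp only [List.flatMap_nil, List.flatMap_cons, List.nil_append, List.append_assoc,
        List.cons_append] at h
      exact absurd h (ht _ _ _)
    | cons b m =>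
      simp only [List.flatMap_cons, List.append_assoc] at h
      obtain ⟨rfl, h'⟩ := he _ _ _ _ h
      obtain ⟨rfl, rfl⟩ := ih m r s (by simpa using h')
      exact ⟨rfl, rfl⟩

theorem encodeLiteral_inj (a b : Literal) (r s : List Symbol)
    (h : encodeLiteral a ++ r = encodeLiteral b ++ s) : a = b ∧ r = s := by
  obtain ⟨v, p⟩ := a
  obtain ⟨w, q⟩ := b
  have key : ∀ v w : List Bool, encodeLiteral ⟨v, p⟩ ++ r = encodeLiteral ⟨w, q⟩ ++ s →
      v = w ∧ p = q ∧ r = s := by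
    intro v
    induction v with
    | nil =>
      intro w h
      cases w <;> cases p <;> cases q <;> simp_all [encodeLiteral]
    | cons x v ih =>
      intro w h
      cases w with
      | nil => cases p <;> cases q <;> simp_all [encodeLiteral]
      | cons y w =>
        simp only [encodeLiteral, List.map_cons, List.cons_append, List.cons.injEq,
          Symbol.bit.injEq] at h
        obtain ⟨rfl, h3⟩ := ih w h.2
        exact ⟨by rw [h.1], h3⟩
  obtain ⟨rfl, rfl, rfl⟩ := key v w h
  exact ⟨rfl, rfl⟩

theorem encodeClause_inj (a b : List Literal) (r s : List Symbol)
    (h : encodeClause a ++ r = encodeClause b ++ s) : a = b ∧ r = s := by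
  refine flatMap_end_inj encodeLiteral Symbol.endClause encodeLiteral_inj ?_ a b r s h
  rintro ⟨_ | _, _ | _⟩ r s <;> simp [encodeLiteral]

theorem encodeFormula_inj (a b : List (List Literal)) (r s : List Symbol)
    (h : encodeFormula a ++ r = encodeFormula b ++ s) : a = b ∧ r = s := by
  refine flatMap_end_inj encodeClause Symbol.endFormula encodeClause_inj ?_ a b r s h
  rintro (_ | ⟨⟨_ | _, _ | _⟩, _⟩) r s <;> simp [encodeClause, encodeLiteral]

theorem encodeInstance_inj {p q : List (List (List Literal))} {f g : List (List Literal)}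
    (h : encodeInstance p f = encodeInstance q g) : p = q ∧ f = g := by
  obtain ⟨h1, h2⟩ :=
    flatMap_end_inj encodeFormula Symbol.turnstile encodeFormula_inj
      (by rintro (_ | ⟨_ | ⟨⟨_ | _, _ | _⟩, _⟩, _⟩) r s <;>
            simp [encodeFormula, encodeClause, encodeLiteral]) p q _ _ h
  exact ⟨h1, (encodeFormula_inj f g [] [] (by simpa using h2)).1⟩

/-- A word encodes at most one instance. -/
theorem IsEncoding.unique {w : List Symbol} {Φ Φ' : Finset CNF} {ψ ψ' : CNF}
    (h : IsEncoding w Φ ψ) (h' : IsEncoding w Φ' ψ') : Φ = Φ' ∧ ψ = ψ' := by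
  obtain ⟨p, f, rfl, rfl, hw⟩ := h
  obtain ⟨q, g, rfl, rfl, hw'⟩ := h'
  obtain ⟨rfl, rfl⟩ := encodeInstance_inj (hw.trans hw'.symm)
  exact ⟨rfl, rfl⟩

/-! ### The class P -/

open Classical in
/-- The class P: the language `L` over the finite alphabet `Γ` is decided by a (multi-stack)
Turing machine that on every word `w` over `Γ` halts after at most polynomially many steps in the
length of `w`, with output `true` if `w ∈ L` and `false` otherwise. -/
def InP {Γ : Type} [Fintype Γ] (L : Language Γ) : Prop :=
  Nonempty (Turing.TM2ComputableInPolyTime (id : List Γ → List Γ) Computability.encodeBool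
    (fun w : List Γ => decide (w ∈ L)))

end KromImp

/-!
The clauses `¬x ∨ y` of a Krom formula are the edges `x ⟶ y` of its implication graph, which is
closed under contraposition. A true literal makes every literal reachable from it true, so a formula
is unsatisfiable if it contains the empty clause or if some `x` and `¬x` lie on a common cycle.
Otherwise a maximal consistent set of literals closed under reachability contains one of `x` and
`¬x` for every `x`, hence is the set of true literals of a satisfying assignment. As `Φ ⊨ C` means
that `Φ` with the negations of the literals of `C` is unsatisfiable, the implication problem reduces
to transitive closures of finite relations.

For the running time, data are binary trees, written in preorder on a stack of bits, and algorithms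
are structured programs over stacks, which compile to Turing machines step by step. The functions
they compute in polynomial time are closed under composition, pairing, and folding over a list
provided that a step of the fold adds to the size of the accumulator at most a polynomial in the
data that are not accumulated. Inputs are decoded by a total right fold, and words that are not
encodings are recognized by encoding the result again.
-/

namespace KromImp

open Turing

/-! ### Structured programs over stacks -/

/-- Structured programs over a family of stacks, the programming language in which polynomial-time
algorithms are written below: `case k f` pops stack `k` and continues according to the symbol found
(`none` if there is none), and `loop k f` pops stack `k` until it is empty, running `f a` on every
symbol `a` popped. -/
inductive Prog {K : Type} (Γ : K → Type) : Type
  | skip : Prog Γ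
  | push (k : K) (a : Γ k) : Prog Γ
  | case (k : K) (f : Option (Γ k) → Prog Γ) : Prog Γ
  | seq (c d : Prog Γ) : Prog Γ
  | loop (k : K) (f : Γ k → Prog Γ) : Prog Γ

namespace Prog

variable {K : Type} {Γ : K → Type}

/-- The labels of the Turing machine code of a program. -/
def Label : Prog Γ → Type
  | skip => Unit
  | push _ _ => Unit
  | case k f => Option (Σ a : Option (Γ k), Label (f a))
  | seq c d => Label c ⊕ Label d
  | loop k f => Option (Σ a : Γ k, Label (f a))

/-- The entry label of a program. -/
def start : (c : Prog Γ) → Label c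
  | skip => ()
  | push _ _ => ()
  | case _ _ => none
  | seq c _ => Sum.inl (start c)
  | loop _ _ => none

theorem finite_label [∀ k, Finite (Γ k)] (c : Prog Γ) : Finite (Label c) := by
  induction c with
  | skip => exact inferInstanceAs (Finite Unit)
  | push => exact inferInstanceAs (Finite Unit)
  | case k f ih =>
    have := ih
    exact inferInstanceAs (Finite (Option (Σ a : Option (Γ k), Label (f a))))
  | seq c d => exact inferInstanceAs (Finite (Label c ⊕ Label d))
  | loop k f ih =>
    have := ih
    exact inferInstanceAs (Finite (Option (Σ a : Γ k, Label (f a))))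

variable [DecidableEq K]

/-- Big-step semantics: `Exec c S S' t` means that `c` turns the stacks `S` into `S'` in exactly `t`
steps of its Turing machine code. -/
inductive Exec : Prog Γ → (∀ k, List (Γ k)) → (∀ k, List (Γ k)) → ℕ → Prop
  | skip (S) : Exec skip S S 1
  | push (S k a) : Exec (push k a) S (Function.update S k (a :: S k)) 1
  | case {S S' k f t} : Exec (f (S k).head?) (Function.update S k (S k).tail) S' t →
      Exec (case k f) S S' (t + 1)
  | seq {S S' S'' c d t t'} : Exec c S S' t → Exec d S' S'' t' → Exec (seq c d) S S'' (t + t')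
  | loop_nil {S k} {f : Γ k → Prog Γ} : S k = [] → Exec (loop k f) S S 1
  | loop_cons {S S' S'' k a l t t'} {f : Γ k → Prog Γ} : S k = a :: l →
      Exec (f a) (Function.update S k l) S' t → Exec (loop k f) S' S'' t' →
      Exec (loop k f) S S'' (t + t' + 1)

theorem Exec.length_le {c : Prog Γ} {S S' : ∀ k, List (Γ k)} {t : ℕ} (h : Exec c S S' t) (j : K) :
    (S' j).length ≤ (S j).length + t := by
  have length_update_le : ∀ (S : ∀ k, List (Γ k)) k (l : List (Γ k)),
      l.length ≤ (S k).length → (Function.update S k l j).length ≤ (S j).length := by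
    intro S k l hl
    by_cases hj : j = k
    · subst hj
      simpa using hl
    · simp [hj]
  induction h with
  | skip S => omega
  | push S k a =>
    by_cases hj : j = k
    · subst hj
      simp
    · simp [hj]
  | @case S S' k _ t _ ih =>
    have := length_update_le S k (S k).tail (by simp)
    omega
  | seq _ _ ih ih' => omega
  | loop_nil => omega
  | @loop_cons S S' S'' k a l t t' _ hS _ _ ih ih' =>
    have := length_update_le S k l (by simp [hS])
    omega

/-- The Turing machine code of a program whose labels are embedded by `e`, with exit label `x`.
The internal state of the machine stores the symbol popped last from each stack. -/
def code : (c : Prog Γ) → {L : Type} → (Label c → L) → L → Label c →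
    TM2.Stmt Γ L (∀ k, Option (Γ k))
  | skip, _, _, x, _ => .goto fun _ => x
  | push k a, _, _, x, _ => .push k (fun _ => a) (.goto fun _ => x)
  | case k f, _, e, _, none =>
    .pop k (fun v a => Function.update v k a) (.goto fun v => e (some ⟨v k, start (f (v k))⟩))
  | case _ f, _, e, x, some ⟨a, l⟩ => code (f a) (fun l => e (some ⟨a, l⟩)) x l
  | seq c d, _, e, _, Sum.inl l => code c (fun l => e (Sum.inl l)) (e (Sum.inr (start d))) l
  | seq _ d, _, e, x, Sum.inr l => code d (fun l => e (Sum.inr l)) x l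
  | loop k f, _, e, x, none =>
    .pop k (fun v a => Function.update v k a)
      (.goto fun v => (v k).elim x fun a => e (some ⟨a, start (f a)⟩))
  | loop _ f, _, e, _, some ⟨a, l⟩ => code (f a) (fun l => e (some ⟨a, l⟩)) (e none) l

/-- `n` steps of the machine `M` lead from `a` to `b`. -/
def Steps {L σ : Type} (M : L → TM2.Stmt Γ L σ) (n : ℕ) (a b : TM2.Cfg Γ L σ) : Prop :=
  (flip bind (TM2.step M))^[n] (some a) = some b

section Steps

variable {L σ : Type} {M : L → TM2.Stmt Γ L σ}

theorem Steps.trans {m n : ℕ} {a b c : TM2.Cfg Γ L σ} (h : Steps M m a b) (h' : Steps M n b c) :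
    Steps M (m + n) a c := by
  unfold Steps at *
  rw [Nat.add_comm, Function.iterate_add_apply, h, h']

theorem Steps.cons {n : ℕ} {a b c : TM2.Cfg Γ L σ} (h : Steps M 1 a b) (h' : Steps M n b c) :
    Steps M (n + 1) a c :=
  Nat.add_comm n 1 ▸ h.trans h'

theorem Steps.single (l : L) (v : σ) (S : ∀ k, List (Γ k)) :
    Steps M 1 ⟨some l, v, S⟩ (TM2.stepAux (M l) v S) := rfl

theorem Steps.of_stmt_eq {l : L} {q : TM2.Stmt Γ L σ} (h : M l = q) (v : σ) (S : ∀ k, List (Γ k)) :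
    Steps M 1 ⟨some l, v, S⟩ (TM2.stepAux q v S) :=
  h ▸ Steps.single l v S

end Steps

section Code

variable {L : Type} {M : L → TM2.Stmt Γ L (∀ k, Option (Γ k))} {x : L} {k : K}

theorem steps_case {f : Option (Γ k) → Prog Γ} {e : Label (case k f) → L}
    (hM : M (e none) = code (case k f) e x none) (v : ∀ k, Option (Γ k)) (S : ∀ k, List (Γ k)) :
    Steps M 1 ⟨some (e none), v, S⟩ ⟨some (e (some ⟨(S k).head?, start (f (S k).head?)⟩)),
      Function.update v k (S k).head?, Function.update S k (S k).tail⟩ := by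
  have h := Steps.of_stmt_eq hM v S
  have label_congr : ∀ o, o = (S k).head? →
      e (some ⟨o, start (f o)⟩) = e (some ⟨(S k).head?, start (f (S k).head?)⟩) := by
    rintro _ rfl
    rfl
  simp only [code, TM2.stepAux] at h
  rwa [label_congr _ (Function.update_self (β := fun k => Option (Γ k)) k _ v)] at h

variable {f : Γ k → Prog Γ} {e : Label (loop k f) → L}

theorem steps_loop_nil (hM : M (e none) = code (loop k f) e x none) (v : ∀ k, Option (Γ k))
    {S : ∀ k, List (Γ k)} (hS : S k = []) :
    Steps M 1 ⟨some (e none), v, S⟩ ⟨some x, Function.update v k none, S⟩ := by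
  have h := Steps.of_stmt_eq hM v S
  simp only [code, TM2.stepAux, Function.update_self, hS, List.head?_nil, List.tail_nil,
    Option.elim_none] at h
  rwa [← hS, Function.update_eq_self] at h

theorem steps_loop_cons (hM : M (e none) = code (loop k f) e x none) (v : ∀ k, Option (Γ k))
    {S : ∀ k, List (Γ k)} {a : Γ k} {l : List (Γ k)} (hS : S k = a :: l) :
    Steps M 1 ⟨some (e none), v, S⟩
      ⟨some (e (some ⟨a, start (f a)⟩)), Function.update v k (some a), Function.update S k l⟩ := by
  have h := Steps.of_stmt_eq hM v S
  simpa only [code, TM2.stepAux, Function.update_self, hS, List.head?_cons, List.tail_cons,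
    Option.elim_some] using h

end Code

theorem Exec.steps {c : Prog Γ} {S S' : ∀ k, List (Γ k)} {t : ℕ} (h : Exec c S S' t) :
    ∀ {L : Type} (M : L → TM2.Stmt Γ L (∀ k, Option (Γ k))) (e : Label c → L) (x : L),
      (∀ l, M (e l) = code c e x l) → ∀ v, ∃ v',
        Steps M t ⟨some (e (start c)), v, S⟩ ⟨some x, v', S'⟩ := by
  induction h with
  | skip S => exact fun M e x hM v => ⟨v, Steps.of_stmt_eq (hM ()) v S⟩
  | push S k a => exact fun M e x hM v => ⟨v, Steps.of_stmt_eq (hM ()) v S⟩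
  | @case S S' k f t _ ih =>
    intro L M e x hM v
    obtain ⟨v', h'⟩ := ih M (fun l => e (some ⟨_, l⟩)) x (fun l => hM (some ⟨_, l⟩))
      (Function.update v k (S k).head?)
    exact ⟨v', (steps_case (hM none) v S).cons h'⟩
  | @seq S S' S'' c d t t' _ _ ih ih' =>
    intro L M e x hM v
    obtain ⟨v', h'⟩ := ih M (fun l => e (Sum.inl l)) (e (Sum.inr (start d)))
      (fun l => hM (Sum.inl l)) v
    obtain ⟨v'', h''⟩ := ih' M (fun l => e (Sum.inr l)) x (fun l => hM (Sum.inr l)) v'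
    exact ⟨v'', h'.trans h''⟩
  | loop_nil hS => exact fun M e x hM v => ⟨_, steps_loop_nil (hM none) v hS⟩
  | @loop_cons S S' S'' k a l t t' f hS _ _ ih ih' =>
    intro L M e x hM v
    obtain ⟨v', h'⟩ := ih M (fun l => e (some ⟨_, l⟩)) (e none) (fun l => hM (some ⟨_, l⟩))
      (Function.update v k (some a))
    obtain ⟨v'', h''⟩ := ih' M e x hM v'
    exact ⟨v'', (steps_loop_cons (hM none) v hS).cons (h'.trans h'')⟩

/-- The Turing machine that runs a program, with input stack `k₀` and output stack `k₁`. -/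
noncomputable def toFinTM2 [Fintype K] [∀ k, Fintype (Γ k)] (c : Prog Γ) (k₀ k₁ : K) : FinTM2 :=
  haveI := finite_label c
  { K := K
    k₀ := k₀
    k₁ := k₁
    Γ := Γ
    Λ := Option (Label c)
    main := some (start c)
    ΛFin := Fintype.ofFinite _
    σ := ∀ k, Option (Γ k)
    initialState := fun _ => none
    m := fun l => l.elim (.load (fun _ _ => none) .halt) (code c some none) }

theorem Exec.steps_toFinTM2 [Fintype K] [∀ k, Fintype (Γ k)] {c : Prog Γ} {k₀ k₁ : K}
    {S S' : ∀ k, List (Γ k)} {t : ℕ} (h : Exec c S S' t) :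
    (flip bind (c.toFinTM2 k₀ k₁).step)^[t + 1]
        (some (⟨some (some (start c)), fun _ => none, S⟩ : (c.toFinTM2 k₀ k₁).Cfg)) =
      some (⟨none, fun _ => none, S'⟩ : (c.toFinTM2 k₀ k₁).Cfg) := by
  obtain ⟨v', h'⟩ := h.steps (c.toFinTM2 k₀ k₁).m some none (fun l => rfl) (fun _ => none)
  exact h'.trans (Steps.single _ _ _)

/-- The program `c` turns `S` into `S'` within `n` steps. -/
def Runs (c : Prog Γ) (S S' : ∀ k, List (Γ k)) (n : ℕ) : Prop :=
  ∃ t ≤ n, Exec c S S' t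

section Runs

variable {c d : Prog Γ} {S S' S'' : ∀ k, List (Γ k)} {k : K} {m n : ℕ}

theorem Runs.mono (h : Runs c S S' m) (hmn : m ≤ n) : Runs c S S' n :=
  let ⟨t, ht, h⟩ := h
  ⟨t, ht.trans hmn, h⟩

theorem Runs.length_le (h : Runs c S S' n) (k : K) : (S' k).length ≤ (S k).length + n :=
  let ⟨_, ht, h⟩ := h
  (h.length_le k).trans (Nat.add_le_add_left ht _)

theorem Runs.skip (S : ∀ k, List (Γ k)) : Runs skip S S 1 :=
  ⟨1, le_rfl, .skip S⟩

theorem Runs.push (S : ∀ k, List (Γ k)) (k : K) (a : Γ k) :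
    Runs (push k a) S (Function.update S k (a :: S k)) 1 :=
  ⟨1, le_rfl, .push S k a⟩

theorem Runs.seq (h : Runs c S S' m) (h' : Runs d S' S'' n) : Runs (c.seq d) S S'' (m + n) :=
  let ⟨_, ht, h⟩ := h
  let ⟨_, ht', h'⟩ := h'
  ⟨_, Nat.add_le_add ht ht', h.seq h'⟩

theorem Runs.case_cons {f : Option (Γ k) → Prog Γ} {a : Γ k} {l : List (Γ k)} (hS : S k = a :: l)
    (h : Runs (f (some a)) (Function.update S k l) S' n) : Runs (case k f) S S' (n + 1) := by
  obtain ⟨t, ht, h⟩ := h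
  refine ⟨_, Nat.add_le_add_right ht 1, .case ?_⟩
  rwa [hS]

theorem Runs.loop_nil {f : Γ k → Prog Γ} (hS : S k = []) : Runs (loop k f) S S 1 :=
  ⟨1, le_rfl, .loop_nil hS⟩

theorem Runs.loop_cons {f : Γ k → Prog Γ} {a : Γ k} {l : List (Γ k)} (hS : S k = a :: l)
    (h : Runs (f a) (Function.update S k l) S' m) (h' : Runs (loop k f) S' S'' n) :
    Runs (loop k f) S S'' (m + n + 1) :=
  let ⟨_, ht, h⟩ := h
  let ⟨_, ht', h'⟩ := h'
  ⟨_, by omega, .loop_cons hS h h'⟩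

end Runs

section AddStack

variable {A : Type}

/-- The same program over a family with an additional stack `none`, which it does not touch. -/
def addStack (A : Type) : Prog Γ → Prog (fun o : Option K => o.elim A Γ)
  | skip => .skip
  | push k a => .push (some k) a
  | case k f => .case (some k) fun a => addStack A (f a)
  | seq c d => .seq (addStack A c) (addStack A d)
  | loop k f => .loop (some k) fun a => addStack A (f a)

/-- The stack contents with an additional stack `none`. -/
def consStack (w : List A) (S : ∀ k, List (Γ k)) : ∀ o : Option K, List (o.elim A Γ)
  | none => w
  | some k => S k

theorem update_consStack_none (w v : List A) (S : ∀ k, List (Γ k)) :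
    Function.update (consStack w S) none v = consStack v S := by
  funext o
  cases o <;> rfl

theorem update_consStack_some (w : List A) (S : ∀ k, List (Γ k)) (k : K) (l : List (Γ k)) :
    Function.update (consStack w S) (some k) l = consStack w (Function.update S k l) := by
  funext o
  cases o with
  | none => rfl
  | some j =>
    by_cases hj : j = k
    · subst hj
      exact (Function.update_self (some j) l (consStack w S)).trans
        (Function.update_self j l S).symm
    · exact (Function.update_of_ne (mt (Option.some_injective K ·) hj) l (consStack w S)).trans
        (Function.update_of_ne hj l S).symm

theorem Exec.addStack {c : Prog Γ} {S S' : ∀ k, List (Γ k)} {t : ℕ} (h : Exec c S S' t)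
    (w : List A) : Exec (c.addStack A) (consStack w S) (consStack w S') t := by
  induction h with
  | skip S => exact .skip _
  | push S k a => exact update_consStack_some w S k (a :: S k) ▸ .push _ _ _
  | @case S S' k f t _ ih =>
    exact .case (k := some k) (update_consStack_some w S k (S k).tail ▸ ih)
  | seq _ _ ih ih' => exact .seq ih ih'
  | loop_nil hS => exact .loop_nil hS
  | @loop_cons S S' S'' k a l t t' f hS _ _ ih ih' =>
    exact .loop_cons (k := some k) hS (update_consStack_some w S k l ▸ ih) ih'

theorem Runs.addStack {c : Prog Γ} {S S' : ∀ k, List (Γ k)} {n : ℕ} (h : Runs c S S' n)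
    (w : List A) : Runs (c.addStack A) (consStack w S) (consStack w S') n :=
  let ⟨t, ht, h⟩ := h
  ⟨t, ht, h.addStack w⟩

end AddStack

end Prog

/-! ### Binary trees on stacks of bits -/

/-- The work stacks: `main` holds the data, the others are empty between operations. -/
inductive Work
  | main | aux | tmp | cnt
deriving DecidableEq

instance : Fintype Work := ⟨{.main, .aux, .tmp, .cnt}, by rintro (_ | _ | _ | _) <;> decide⟩

/-- The contents of the work stacks, given stack by stack. -/
def workStacks (m x z c : List Bool) : Work → List Bool
  | .main => m
  | .aux => x
  | .tmp => z
  | .cnt => c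

/-- The work stacks between operations. -/
abbrev onMain (m : List Bool) : Work → List Bool := workStacks m [] [] []

section workStacks

variable (m x z c l : List Bool)

@[simp] theorem workStacks_main : workStacks m x z c .main = m := rfl
@[simp] theorem workStacks_aux : workStacks m x z c .aux = x := rfl
@[simp] theorem workStacks_tmp : workStacks m x z c .tmp = z := rfl
@[simp] theorem workStacks_cnt : workStacks m x z c .cnt = c := rfl

@[simp] theorem update_workStacks_main :
    Function.update (workStacks m x z c) .main l = workStacks l x z c := by
  funext k; cases k <;> rfl

@[simp] theorem update_workStacks_aux :
    Function.update (workStacks m x z c) .aux l = workStacks m l z c := by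
  funext k; cases k <;> rfl

@[simp] theorem update_workStacks_tmp :
    Function.update (workStacks m x z c) .tmp l = workStacks m x l c := by
  funext k; cases k <;> rfl

@[simp] theorem update_workStacks_cnt :
    Function.update (workStacks m x z c) .cnt l = workStacks m x z l := by
  funext k; cases k <;> rfl

end workStacks

/-- A type whose elements are represented by binary trees. -/
class TreeEnc (α : Type) where
  enc : α → BinaryTree Unit
  enc_injective : Function.Injective enc

open TreeEnc

/-- The preorder code of a binary tree. -/
def treeCode : BinaryTree Unit → List Bool
  | .nil => [false]
  | .node _ l r => true :: (treeCode l ++ treeCode r)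

theorem treeCode_injective : Function.Injective treeCode := by
  have prefix_free : ∀ (T U : BinaryTree Unit) (r s : List Bool),
      treeCode T ++ r = treeCode U ++ s → T = U ∧ r = s := by
    intro T
    induction T with
    | nil => rintro (_ | _) r s h <;> simp_all [treeCode]
    | node _ a b iha ihb =>
      rintro (_ | ⟨_, a', b'⟩) r s h
      · simp [treeCode] at h
      · simp only [treeCode, List.cons_append, List.append_assoc, List.cons.injEq, true_and] at h
        obtain ⟨rfl, hb⟩ := iha _ _ _ h
        obtain ⟨rfl, hr⟩ := ihb _ _ _ hb
        exact ⟨rfl, hr⟩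
  exact fun T U h => (prefix_free T U [] [] (by rw [h])).1

section bits

variable {α : Type} [TreeEnc α]

/-- The bit string that represents `a`. -/
def bits (a : α) : List Bool := treeCode (enc a)

/-- The length of the bit string that represents `a`. -/
def size (a : α) : ℕ := (bits a).length

theorem bits_injective : Function.Injective (bits : α → List Bool) :=
  treeCode_injective.comp enc_injective

theorem size_pos (a : α) : 0 < size a := by
  unfold size bits
  cases enc a <;> simp [treeCode]

end bits

open Prog Work

/-- Programs over the work stacks. -/
abbrev BitProg : Type := Prog fun _ : Work => Bool

namespace BitProg

/-- Move the contents of stack `j` to stack `k`, reversing their order. -/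
def move (j k : Work) : BitProg := loop j fun b => push k b

theorem runs_move {j k : Work} (hjk : j ≠ k) (S : Work → List Bool) :
    Runs (move j k) S (Function.update (Function.update S k ((S j).reverse ++ S k)) j [])
      (2 * (S j).length + 1) := by
  induction hl : S j generalizing S with
  | nil =>
    have unchanged : Function.update (Function.update S k (S k)) j [] = S := by
      rw [Function.update_eq_self, ← hl, Function.update_eq_self]
    rw [List.reverse_nil, List.nil_append, unchanged]
    exact (Runs.loop_nil hl).mono (by omega)
  | cons b l ih =>
    have moved := ih (Function.update (Function.update S j l) k (b :: S k)) (by simp [hjk])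
    have hpush := Runs.push (Function.update S j l) k b
    simp only [Function.update_self, Function.update_idem, Function.update_comm hjk,
      Function.update_of_ne hjk.symm] at moved hpush
    rw [List.reverse_cons, List.append_assoc]
    refine (Runs.loop_cons hl hpush moved).mono ?_
    simp only [List.length_cons]
    omega

theorem runs_clear_aux (m x : List Bool) :
    Runs (loop aux fun _ => skip : BitProg) (workStacks m x [] []) (onMain m)
      (2 * x.length + 1) := by
  induction x with
  | nil => exact .loop_nil rfl
  | cons b x ih =>
    refine (Runs.loop_cons rfl (.skip _) (by simpa using ih)).mono ?_
    simp only [List.length_cons]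
    omega

theorem runs_copy_aux (m x z : List Bool) :
    Runs (loop aux fun b => seq (push main b) (push tmp b) : BitProg) (workStacks m x z [])
      (workStacks (x.reverse ++ m) [] (x.reverse ++ z) []) (3 * x.length + 1) := by
  induction x generalizing m z with
  | nil => exact .loop_nil rfl
  | cons b x ih =>
    have hpush := (Runs.push (workStacks m x z []) main b).seq (Runs.push _ tmp b)
    simp only [workStacks_main, update_workStacks_main, workStacks_tmp,
      update_workStacks_tmp] at hpush
    rw [List.reverse_cons, List.append_assoc, List.append_assoc]
    refine (Runs.loop_cons rfl (by simpa using hpush) (ih (b :: m) (b :: z))).mono ?_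
    simp only [List.length_cons]
    omega

/-- Push a list of bits on the main stack so that its head is on top. -/
def pushAll : List Bool → BitProg
  | [] => skip
  | b :: l => seq (pushAll l) (push main b)

theorem runs_push_main (b : Bool) (m : List Bool) {x z c : List Bool} :
    Runs (push main b : BitProg) (workStacks m x z c) (workStacks (b :: m) x z c) 1 := by
  simpa using Runs.push (workStacks m x z c) main b

theorem runs_push_cnt (b : Bool) {m x z c : List Bool} :
    Runs (push cnt b : BitProg) (workStacks m x z c) (workStacks m x z (b :: c)) 1 := by
  simpa using Runs.push (workStacks m x z c) cnt b

theorem runs_pushAll (l m : List Bool) {x z c : List Bool} :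
    Runs (pushAll l) (workStacks m x z c) (workStacks (l ++ m) x z c) (l.length + 1) := by
  induction l with
  | nil => exact .skip _
  | cons b l ih => exact ih.seq (runs_push_main b _)

theorem runs_case_main {f : Option Bool → BitProg} {b : Bool} {m x z c : List Bool}
    {S : Work → List Bool} {n : ℕ} (h : Runs (f (some b)) (workStacks m x z c) S n) :
    Runs (case main f : BitProg) (workStacks (b :: m) x z c) S (n + 1) :=
  .case_cons rfl (by simpa using h)

theorem runs_loop_cnt {f : Bool → BitProg} {b : Bool} {m x z c : List Bool}
    {S S' : Work → List Bool} {n n' : ℕ} (h : Runs (f b) (workStacks m x z c) S n)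
    (h' : Runs (loop cnt f : BitProg) S S' n') :
    Runs (loop cnt f : BitProg) (workStacks m x z (b :: c)) S' (n + n' + 1) :=
  .loop_cons rfl (by simpa using h) h'

/-- Move as many trees as the stack `cnt` has symbols from the main stack to the stack `aux`,
where their codes are reversed. -/
def moveTrees : BitProg :=
  loop cnt fun _ => case main fun
    | some true => seq (push aux true) (seq (push cnt true) (push cnt true))
    | _ => push aux false

theorem runs_moveTrees_cons (T : BinaryTree Unit) {m x z c : List Bool} {S : Work → List Bool}
    {n : ℕ} (h : Runs moveTrees (workStacks m ((treeCode T).reverse ++ x) z c) S n) :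
    Runs moveTrees (workStacks (treeCode T ++ m) x z (true :: c)) S
      (n + 5 * (treeCode T).length) := by
  induction T generalizing m x c n with
  | nil =>
    have hpush : Runs (push aux false : BitProg) (workStacks m x z c)
        (workStacks m (false :: x) z c) 1 := by
      simpa using Runs.push (workStacks m x z c) aux false
    refine (runs_loop_cnt (runs_case_main hpush) h).mono ?_
    simp only [treeCode, List.length_singleton]
    omega
  | node _ T U ihT ihU =>
    have hpush : Runs (seq (push aux true) (seq (push cnt true) (push cnt true)) : BitProg)
        (workStacks (treeCode T ++ (treeCode U ++ m)) x z c)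
        (workStacks (treeCode T ++ (treeCode U ++ m)) (true :: x) z (true :: true :: c)) 3 := by
      simpa using (Runs.push (workStacks (treeCode T ++ (treeCode U ++ m)) x z c) aux true).seq
        ((Runs.push _ cnt true).seq (Runs.push _ cnt true))
    simp only [treeCode, List.reverse_cons, List.reverse_append, List.append_assoc,
      List.cons_append, List.nil_append] at h ⊢
    refine (runs_loop_cnt (runs_case_main hpush) (ihT (ihU h))).mono ?_
    simp only [List.length_cons, List.length_append]
    omega

/-- Move a tree from the main stack to the stack `aux`, where its code is reversed. -/
def moveTree : BitProg := seq (push cnt true) moveTrees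

section TreeOperations

variable {α β : Type} [TreeEnc α] [TreeEnc β]

theorem runs_moveTree (a : α) (m x z : List Bool) :
    Runs moveTree (workStacks (bits a ++ m) x z []) (workStacks m ((bits a).reverse ++ x) z [])
      (5 * size a + 2) := by
  refine ((runs_push_cnt true).seq (runs_moveTrees_cons (enc a) (.loop_nil rfl))).mono ?_
  simp only [size, bits]
  omega

/-- Remove the top tree of the main stack. -/
def dropTree : BitProg := seq moveTree (loop aux fun _ => skip)

theorem runs_dropTree (a : α) (m : List Bool) :
    Runs dropTree (onMain (bits a ++ m)) (onMain m) (7 * size a + 3) := by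
  refine ((runs_moveTree a m [] []).seq (runs_clear_aux m _)).mono ?_
  simp only [size, List.append_nil, List.length_reverse]
  omega

/-- Duplicate the top tree of the main stack. -/
def dupTree : BitProg :=
  seq moveTree (seq (loop aux fun b => seq (push main b) (push tmp b))
    (seq (move tmp aux) (move aux main)))

theorem runs_dupTree (a : α) (m : List Bool) :
    Runs dupTree (onMain (bits a ++ m)) (onMain (bits a ++ (bits a ++ m))) (12 * size a + 5) := by
  have h := (runs_moveTree a m [] []).seq ((runs_copy_aux _ _ _).seq
    ((runs_move (j := tmp) (k := aux) (by decide) _).seq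
      (runs_move (j := aux) (k := main) (by decide) _)))
  simp only [workStacks_main, workStacks_aux, workStacks_tmp, update_workStacks_main,
    update_workStacks_aux, update_workStacks_tmp, List.append_nil, List.reverse_reverse,
    List.length_reverse] at h
  refine h.mono ?_
  simp only [size]
  omega

/-- Swap the two top trees of the main stack. -/
def swapTree : BitProg :=
  seq (seq moveTree (move aux tmp))
    (seq moveTree (seq (move tmp cnt) (seq (move cnt main) (move aux main))))

theorem runs_swapTree (a : α) (b : β) (m : List Bool) :
    Runs swapTree (onMain (bits a ++ (bits b ++ m))) (onMain (bits b ++ (bits a ++ m)))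
      (11 * size a + 7 * size b + 8) := by
  have hab := (runs_moveTree a (bits b ++ m) [] []).seq
    (runs_move (j := aux) (k := tmp) (by decide) _)
  simp only [workStacks_aux, workStacks_tmp, update_workStacks_aux, update_workStacks_tmp,
    List.append_nil, List.reverse_reverse, List.length_reverse] at hab
  have hba := (runs_moveTree b m [] (bits a)).seq
    ((runs_move (j := tmp) (k := cnt) (by decide) _).seq
      ((runs_move (j := cnt) (k := main) (by decide) _).seq
        (runs_move (j := aux) (k := main) (by decide) _)))
  simp only [workStacks_main, workStacks_aux, workStacks_tmp, workStacks_cnt,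
    update_workStacks_main, update_workStacks_aux, update_workStacks_tmp, update_workStacks_cnt,
    List.append_nil, List.reverse_reverse, List.length_reverse] at hba
  refine (hab.seq hba).mono ?_
  simp only [size]
  omega

end TreeOperations

end BitProg

/-! ### Polynomial-time functions -/

open BitProg Polynomial

instance : TreeEnc Bool where
  enc b := bif b then .node () .nil .nil else .nil
  enc_injective := by rintro (_ | _) (_ | _) h <;> simp_all

instance {α β : Type} [TreeEnc α] [TreeEnc β] : TreeEnc (α × β) where
  enc p := .node () (enc p.1) (enc p.2)
  enc_injective := by
    rintro ⟨a, b⟩ ⟨a', b'⟩ h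
    simpa [enc_injective.eq_iff] using h

/-- The representation of lists by right combs. -/
def encList {α : Type} [TreeEnc α] : List α → BinaryTree Unit
  | [] => .nil
  | a :: l => .node () (enc a) (encList l)

theorem encList_injective {α : Type} [TreeEnc α] :
    Function.Injective (encList : List α → BinaryTree Unit) := by
  intro l
  induction l with
  | nil => rintro (_ | _) h <;> simp_all [encList]
  | cons a l ih =>
    rintro (_ | ⟨b, m⟩) h
    · simp [encList] at h
    · simp only [encList, BinaryTree.node.injEq, true_and] at h
      rw [enc_injective h.1, ih h.2]

instance {α : Type} [TreeEnc α] : TreeEnc (List α) := ⟨encList, encList_injective⟩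

section size

variable {α β : Type} [TreeEnc α] [TreeEnc β]

@[simp] theorem bits_pair (a : α) (b : β) : bits (a, b) = true :: (bits a ++ bits b) := rfl

@[simp] theorem bits_cons (a : α) (l : List α) : bits (a :: l) = true :: (bits a ++ bits l) := rfl

@[simp] theorem size_pair (a : α) (b : β) : size (a, b) = size a + size b + 1 := by
  simp [size]

@[simp] theorem size_nil : size ([] : List α) = 1 := rfl

@[simp] theorem size_cons (a : α) (l : List α) : size (a :: l) = size a + size l + 1 := by
  simp [size]

theorem size_bool_le (b : Bool) : size b ≤ 3 := by
  cases b <;> decide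

theorem size_append (l m : List α) : size (l ++ m) + 1 = size l + size m := by
  induction l with
  | nil => simp [Nat.add_comm]
  | cons a l ih =>
    simp only [List.cons_append, size_cons]
    omega

theorem size_le_of_sublist {l m : List α} (h : l.Sublist m) : size l ≤ size m := by
  induction h with
  | slnil => rfl
  | cons a _ ih => simp only [size_cons]; omega
  | cons_cons a _ ih => simp only [size_cons]; omega

theorem length_lt_size (l : List α) : l.length < size l := by
  induction l with
  | nil => simp
  | cons a l ih => simp only [List.length_cons, size_cons]; omega

end size

theorem eval_mono (p : ℕ[X]) {m n : ℕ} (h : m ≤ n) : p.eval m ≤ p.eval n := by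
  simp only [eval_eq_sum_range]
  gcongr

/-- `f` is computed on the top of the main stack by a structured program whose running time is
bounded by a polynomial in the size of the argument. -/
@[fun_prop]
def PolyTime {α β : Type} [TreeEnc α] [TreeEnc β] (f : α → β) : Prop :=
  ∃ (c : BitProg) (p : ℕ[X]), ∀ a m,
    Runs c (onMain (bits a ++ m)) (onMain (bits (f a) ++ m)) (p.eval (size a))

namespace PolyTime

variable {α β γ : Type} [TreeEnc α] [TreeEnc β] [TreeEnc γ]

/-- Every step of a program lengthens the stacks by at most one symbol. -/
theorem exists_size_le {f : α → β} (hf : PolyTime f) :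
    ∃ p : ℕ[X], ∀ a, size (f a) ≤ p.eval (size a) := by
  obtain ⟨c, p, hp⟩ := hf
  refine ⟨X + p, fun a => ?_⟩
  simpa [size] using (hp a []).length_le main

theorem of_enc_eq {f : α → β} (h : ∀ a, enc (f a) = enc a) : PolyTime f := by
  refine ⟨skip, 1, fun a m => ?_⟩
  rw [show bits (f a) = bits a from congrArg treeCode (h a), eval_one]
  exact .skip _

@[fun_prop]
theorem id : PolyTime fun a : α => a := of_enc_eq fun _ => rfl

@[fun_prop]
theorem comp {g : β → γ} {f : α → β} (hg : PolyTime g) (hf : PolyTime f) :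
    PolyTime fun a => g (f a) := by
  obtain ⟨s, hs⟩ := hf.exists_size_le
  obtain ⟨c, p, hp⟩ := hf
  obtain ⟨d, q, hq⟩ := hg
  refine ⟨seq c d, p + q.comp s, fun a m => ((hp a m).seq (hq (f a) m)).mono ?_⟩
  rw [eval_add, eval_comp]
  exact Nat.add_le_add_left (eval_mono q (hs a)) _

@[fun_prop]
theorem const (b : β) : PolyTime fun _ : α => b := by
  refine ⟨seq dropTree (pushAll (bits b)), 7 * X + C (size b + 4), fun a m =>
    ((runs_dropTree a m).seq (runs_pushAll (bits b) m)).mono ?_⟩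
  simp only [size, eq_natCast, Nat.cast_add, Nat.cast_ofNat, eval_add, eval_mul, eval_ofNat,
    eval_X, eval_natCast, Nat.cast_id]
  omega

@[fun_prop]
theorem prodMk {f : α → β} {g : α → γ} (hf : PolyTime f) (hg : PolyTime g) :
    PolyTime fun a => (f a, g a) := by
  obtain ⟨s, hs⟩ := hf.exists_size_le
  obtain ⟨u, hu⟩ := hg.exists_size_le
  obtain ⟨c, p, hp⟩ := hf
  obtain ⟨d, q, hq⟩ := hg
  refine ⟨seq dupTree (seq c (seq swapTree (seq d (seq swapTree (push main true))))),
    p + q + 18 * s + 11 * u + 19 * X + 22, fun a m => ?_⟩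
  rw [bits_pair, List.cons_append, List.append_assoc]
  refine ((runs_dupTree a m).seq ((hp a _).seq ((runs_swapTree (f a) a m).seq
    ((hq a _).seq ((runs_swapTree (g a) (f a) m).seq (runs_push_main true _)))))).mono ?_
  have hsa := hs a
  have hua := hu a
  simp only [eval_add, eval_mul, eval_X, eval_ofNat]
  omega

@[fun_prop]
theorem fst : PolyTime fun p : α × β => p.1 := by
  refine ⟨case main fun _ => seq swapTree dropTree, 18 * X + 12, fun ⟨a, b⟩ m => ?_⟩
  rw [bits_pair, List.cons_append, List.append_assoc]
  refine (runs_case_main ((runs_swapTree a b m).seq (runs_dropTree b _))).mono ?_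
  simp only [eval_add, eval_mul, eval_X, eval_ofNat, size_pair]
  omega

@[fun_prop]
theorem snd : PolyTime fun p : α × β => p.2 := by
  refine ⟨case main fun _ => dropTree, 7 * X + 4, fun ⟨a, b⟩ m => ?_⟩
  rw [bits_pair, List.cons_append, List.append_assoc]
  refine (runs_case_main (runs_dropTree a _)).mono ?_
  simp only [eval_add, eval_mul, eval_X, eval_ofNat, size_pair]
  omega

theorem of_nil_cons {h : List β × α → γ} (h₀ : PolyTime fun a => h ([], a))
    (h₁ : PolyTime fun p : (β × List β) × α => h (p.1.1 :: p.1.2, p.2)) : PolyTime h := by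
  obtain ⟨c₀, p₀, hp₀⟩ := h₀
  obtain ⟨c₁, p₁, hp₁⟩ := h₁
  refine ⟨case main fun _ => case main fun
    | some true => seq (push main true) (seq (push main true) c₁)
    | _ => c₀, p₀ + p₁ + 4, ?_⟩
  rintro ⟨_ | ⟨b, l⟩, a⟩ m
  · refine (runs_case_main (runs_case_main (b := false) (hp₀ a m))).mono ?_
    have := eval_mono p₀ (show size a ≤ size (([] : List β), a) by rw [size_pair]; omega)
    simp only [eval_add, eval_ofNat]
    omega
  · refine (runs_case_main (runs_case_main (b := true) ((runs_push_main true _).seq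
      ((runs_push_main true _).seq (hp₁ ((b, l), a) m))))).mono ?_
    have : size (b :: l, a) = size ((b, l), a) := by simp
    simp only [eval_add, eval_ofNat, this]
    omega

theorem list_cases {g : α → List β} {h f₀ : α → γ} {f₁ : α × β × List β → γ} (hg : PolyTime g)
    (h₀ : PolyTime f₀) (h₁ : PolyTime f₁) (e₀ : ∀ a, g a = [] → h a = f₀ a)
    (e₁ : ∀ a b l, g a = b :: l → h a = f₁ (a, b, l)) : PolyTime h := by
  have cases_fst : PolyTime fun p : List β × α =>
      match p.1 with
      | [] => f₀ p.2
      | b :: l => f₁ (p.2, b, l) :=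
    of_nil_cons h₀ (by fun_prop)
  convert cases_fst.comp (hg.prodMk id) using 2 with a
  cases hga : g a with
  | nil => exact e₀ a hga
  | cons b l => exact e₁ a b l hga

end PolyTime

/-! ### Folding over lists -/

namespace PolyTime

section Fold

variable {α σ : Type} [TreeEnc α] [TreeEnc σ]

/-- Fold over the list in the top pair of the main stack, where `c` performs a single step; a symbol
on the stack `cnt` asks for another round. -/
def foldLoop (c : BitProg) : BitProg :=
  loop cnt fun _ => case main fun _ => case main fun
    | some true => seq (push main true) (seq (push main true) (seq c (push cnt true)))
    | _ => skip

theorem runs_foldLoop {f : σ → α → σ} {c : BitProg} {p : ℕ[X]}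
    (hp : ∀ (a : α) (l : List α) (s : σ) m, Runs c (onMain (bits ((a, l), s) ++ m))
      (onMain (bits (l, f s a) ++ m)) (p.eval (size ((a, l), s))))
    {N B : ℕ} (l : List α) (s : σ) (hN : size l ≤ N)
    (hB : ∀ l', l' <+: l → size (l'.foldl f s) ≤ B) (m : List Bool) :
    Runs (foldLoop c) (workStacks (bits (l, s) ++ m) [] [] [true])
      (onMain (bits (l.foldl f s) ++ m)) ((l.length + 1) * (p.eval (N + B + 1) + 7)) := by
  induction l generalizing s with
  | nil =>
    refine (runs_loop_cnt (runs_case_main (runs_case_main (b := false) (.skip _)))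
      (.loop_nil rfl)).mono ?_
    simp only [List.length_nil]
    omega
  | cons a l ih =>
    have hN' : size l ≤ N := by rw [size_cons] at hN; omega
    have rest := ih (f s a) hN' fun l' hl' => hB (a :: l') (List.cons_prefix_cons.2 ⟨rfl, hl'⟩)
    refine (runs_loop_cnt (runs_case_main (runs_case_main (b := true)
      ((runs_push_main true _).seq ((runs_push_main true _).seq
        ((hp a l s m).seq (runs_push_cnt true)))))) rest).mono ?_
    have hsize : size ((a, l), s) ≤ N + B + 1 := by
      have := hB [] List.nil_prefix
      simp only [size_cons, size_pair, List.foldl_nil] at *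
      omega
    have := eval_mono p hsize
    simp only [List.length_cons, add_mul] at *
    omega

theorem foldl_pair {f : σ → α → σ} (hf : PolyTime fun p : σ × α => f p.1 p.2) (q : ℕ[X])
    (hq : ∀ (l : List α) s, size (l.foldl f s) ≤ q.eval (size l + size s)) :
    PolyTime fun p : List α × σ => p.1.foldl f p.2 := by
  have hstep : PolyTime fun p : (α × List α) × σ => (p.1.2, f p.2 p.1.1) :=
    prodMk (comp snd fst) (hf.comp (prodMk snd (comp fst fst)))
  obtain ⟨c, p, hp⟩ := hstep
  refine ⟨seq (push cnt true) (foldLoop c), (X + 1) * (p.comp (X + q + 1) + 7) + 1,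
    fun ⟨l, s⟩ m => ?_⟩
  have size_prefix_le : ∀ l', l' <+: l → size (l'.foldl f s) ≤ q.eval (size (l, s)) :=
    fun l' hl' => (hq l' s).trans <| eval_mono q <| by
      have := size_le_of_sublist hl'.sublist
      rw [size_pair]
      omega
  refine ((runs_push_cnt true).seq (runs_foldLoop (N := size (l, s))
    (fun a l s m => hp ((a, l), s) m) l s (by rw [size_pair]; omega) size_prefix_le m)).mono ?_
  have rounds_le : l.length + 1 ≤ size (l, s) + 1 := by
    have := length_lt_size l
    rw [size_pair]
    omega
  simp only [eval_add, eval_mul, eval_comp, eval_X, eval_one, eval_ofNat]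
  rw [add_comm 1]
  gcongr

end Fold

section FoldParam

variable {α β γ : Type} [TreeEnc α] [TreeEnc β] [TreeEnc γ]

theorem size_foldl_le {f : β → α → β} {n : ℕ} {q : ℕ[X]}
    (hq : ∀ b a, size (f b a) ≤ size b + q.eval (n + size a)) (l : List α) (b : β) :
    size (l.foldl f b) ≤ size b + size l * q.eval (n + size l) := by
  induction l generalizing b with
  | nil => simp
  | cons a l ih =>
    have step_le : size (f b a) ≤ size b + q.eval (n + size (a :: l)) :=
      (hq b a).trans (Nat.add_le_add_left (eval_mono q (by rw [size_cons]; omega)) _)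
    calc size (l.foldl f (f b a))
        ≤ size (f b a) + size l * q.eval (n + size l) := ih (f b a)
      _ ≤ size b + q.eval (n + size (a :: l)) + size l * q.eval (n + size (a :: l)) :=
        Nat.add_le_add step_le
          (Nat.mul_le_mul_left _ (eval_mono q (by rw [size_cons]; omega)))
      _ = size b + (size l + 1) * q.eval (n + size (a :: l)) := by ring
      _ ≤ size b + size (a :: l) * q.eval (n + size (a :: l)) :=
        Nat.add_le_add_left (Nat.mul_le_mul_right _ (by rw [size_cons]; omega)) _

theorem foldl {l : γ → List α} {b : γ → β} {f : γ → β → α → β} (hl : PolyTime l)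
    (hb : PolyTime b) (hf : PolyTime fun p : γ × β × α => f p.1 p.2.1 p.2.2) (q : ℕ[X])
    (hq : ∀ c b a, size (f c b a) ≤ size b + q.eval (size c + size a)) :
    PolyTime fun c => (l c).foldl (f c) (b c) := by
  let F : γ × β → α → γ × β := fun s a => (s.1, f s.1 s.2 a)
  have foldl_F : ∀ l c b, List.foldl F (c, b) l = (c, List.foldl (f c) b l) := by
    intro l
    induction l with
    | nil => exact fun _ _ => rfl
    | cons a _ ih => exact fun c b => ih c (f c b a)
  have hF : PolyTime fun p : (γ × β) × α => F p.1 p.2 :=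
    prodMk (comp fst fst) (hf.comp
      (prodMk (comp fst fst) (prodMk (comp snd fst) snd)))
  have foldl_pair_F : PolyTime fun p : List α × (γ × β) => p.1.foldl F p.2 := by
    refine foldl_pair hF (X + X * q) ?_
    rintro l ⟨c, b⟩
    have hsize := size_foldl_le (hq c) l b
    have := Nat.mul_le_mul (show size l ≤ size l + size (c, b) by omega)
      (eval_mono q (show size c + size l ≤ size l + size (c, b) by rw [size_pair]; omega))
    rw [foldl_F]
    simp only [eval_add, eval_mul, eval_X, size_pair] at *
    omega
  have h := comp snd (foldl_pair_F.comp (prodMk hl (prodMk id hb)))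
  simpa only [foldl_F] using h

end FoldParam

end PolyTime

/-! ### Polynomial-time list operations and decidable predicates -/

section ListOperations

variable {α β γ : Type} [TreeEnc α] [TreeEnc β] [TreeEnc γ]

namespace PolyTime

@[fun_prop]
theorem cons {f : α → β} {g : α → List β} (hf : PolyTime f) (hg : PolyTime g) :
    PolyTime fun a => f a :: g a :=
  comp (g := fun p : β × List β => p.1 :: p.2) (of_enc_eq fun _ => rfl) (prodMk hf hg)

@[fun_prop]
theorem reverse {l : γ → List α} (hl : PolyTime l) : PolyTime fun c => (l c).reverse := by
  have := foldl (f := fun _ (b : List α) a => a :: b) hl (const []) (by fun_prop) (X + 1)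
    (fun c b a => by simp only [size_cons, eval_add, eval_X, eval_one]; omega)
  simpa using this

theorem foldr {l : γ → List α} {b : γ → β} {f : γ → α → β → β} (hl : PolyTime l)
    (hb : PolyTime b) (hf : PolyTime fun p : γ × α × β => f p.1 p.2.1 p.2.2) (q : ℕ[X])
    (hq : ∀ c a b, size (f c a b) ≤ size b + q.eval (size c + size a)) :
    PolyTime fun c => (l c).foldr (f c) (b c) := by
  have swapped : PolyTime fun p : γ × β × α => f p.1 p.2.2 p.2.1 :=
    hf.comp (g := fun p : γ × α × β => f p.1 p.2.1 p.2.2)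
      (f := fun p : γ × β × α => (p.1, p.2.2, p.2.1)) (by fun_prop)
  simpa using foldl (f := fun c b a => f c a b) hl.reverse hb swapped q fun c b a => hq c a b

@[fun_prop]
theorem append {l m : γ → List α} (hl : PolyTime l) (hm : PolyTime m) :
    PolyTime fun c => l c ++ m c := by
  have := foldr (f := fun _ a (b : List α) => a :: b) hl hm (by fun_prop) (X + 1)
    (fun c a b => by simp only [size_cons, eval_add, eval_X, eval_one]; omega)
  simpa using this

theorem map {l : γ → List α} {f : γ → α → β} (hl : PolyTime l)
    (hf : PolyTime fun p : γ × α => f p.1 p.2) : PolyTime fun c => (l c).map (f c) := by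
  obtain ⟨s, hs⟩ := hf.exists_size_le
  have := foldr (f := fun c a (b : List β) => f c a :: b) hl (const []) (by fun_prop)
    (s.comp (X + 1) + 1) (fun c a b => by
      have := hs (c, a)
      simp only [size_pair, size_cons, eval_add, eval_comp, eval_X, eval_one] at *
      omega)
  simpa only [List.map_eq_foldr] using this

@[fun_prop]
theorem flatten {l : γ → List (List α)} (hl : PolyTime l) : PolyTime fun c => (l c).flatten := by
  have := foldr (f := fun _ (a b : List α) => a ++ b) hl (const []) (by fun_prop) X
    (fun c a b => by have := size_append a b; simp; omega)
  simpa [List.foldr_append_eq_append (f := fun a : List α => a)] using this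

theorem flatMap {l : γ → List α} {f : γ → α → List β} (hl : PolyTime l)
    (hf : PolyTime fun p : γ × α => f p.1 p.2) : PolyTime fun c => (l c).flatMap (f c) := by
  simp only [List.flatMap_def]
  exact flatten (map hl hf)

@[fun_prop]
theorem product {l : γ → List α} {m : γ → List β} (hl : PolyTime l) (hm : PolyTime m) :
    PolyTime fun c => l c ×ˢ m c :=
  flatMap (f := fun c a => (m c).map (Prod.mk a)) hl
    (map (f := fun (p : γ × α) b => (p.2, b)) (by fun_prop) (by fun_prop))

theorem cond {g : α → Bool} {f₁ f₀ : α → β} (hg : PolyTime g) (h₁ : PolyTime f₁)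
    (h₀ : PolyTime f₀) : PolyTime fun a => bif g a then f₁ a else f₀ a := by
  have as_list : PolyTime fun b : Bool => bif b then [false] else [] :=
    of_enc_eq fun b => by cases b <;> rfl
  refine list_cases (f₁ := fun p : α × Bool × List Bool => f₁ p.1) (as_list.comp hg) h₀
    (by fun_prop) (fun a h => ?_) (fun a b l h => ?_) <;>
  cases hga : g a <;> simp_all

end PolyTime

end ListOperations

/-- The predicate `p` has a polynomial-time decision procedure. -/
@[fun_prop]
def PolyDecidable {α : Type} [TreeEnc α] (p : α → Prop) : Prop :=
  ∃ f : α → Bool, PolyTime f ∧ ∀ a, f a = true ↔ p a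

section PolyDecidable

variable {α β γ : Type} [TreeEnc α] [TreeEnc β] [TreeEnc γ] {p q : α → Prop}

theorem PolyTime.ite [DecidablePred p] {f g : α → β} (hp : PolyDecidable p) (hf : PolyTime f)
    (hg : PolyTime g) : PolyTime fun a => if p a then f a else g a := by
  obtain ⟨d, hd, hdp⟩ := hp
  simpa only [← hdp, ← Bool.cond_eq_ite] using cond hd hf hg

theorem PolyTime.decide [DecidablePred p] (hp : PolyDecidable p) :
    PolyTime fun a => decide (p a) := by
  simpa only [Bool.if_true_left, Bool.or_false] using
    ite (f := fun _ => true) (g := fun _ => false) hp (by fun_prop) (by fun_prop)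

namespace PolyDecidable

@[fun_prop]
theorem comp {p : β → Prop} {f : α → β} (hp : PolyDecidable p) (hf : PolyTime f) :
    PolyDecidable fun a => p (f a) :=
  let ⟨d, hd, hdp⟩ := hp
  ⟨fun a => d (f a), hd.comp hf, fun a => hdp (f a)⟩

@[fun_prop]
theorem not (hp : PolyDecidable p) : PolyDecidable fun a => ¬p a := by
  classical
  exact ⟨fun a => if p a then false else true, .ite hp (.const _) (.const _), by simp⟩

@[fun_prop]
theorem and (hp : PolyDecidable p) (hq : PolyDecidable q) : PolyDecidable fun a => p a ∧ q a := by
  classical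
  exact ⟨fun a => if p a then decide (q a) else false, .ite hp (.decide hq) (.const _), by simp⟩

@[fun_prop]
theorem or (hp : PolyDecidable p) (hq : PolyDecidable q) : PolyDecidable fun a => p a ∨ q a := by
  simpa only [not_and_or, not_not] using (hp.not.and hq.not).not

end PolyDecidable

theorem PolyTime.filter {l : γ → List α} {P : γ → α → Prop} [∀ c a, Decidable (P c a)]
    (hl : PolyTime l) (hP : PolyDecidable fun x : γ × α => P x.1 x.2) :
    PolyTime fun c => (l c).filter fun a => P c a := by
  have := foldr (f := fun c a (b : List α) => if P c a then a :: b else b) hl (const [])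
    (ite (by fun_prop) (by fun_prop) (by fun_prop)) (X + 1) (fun c a b => by
      split_ifs <;> simp; omega)
  simpa only [List.filter_eq_foldr, Bool.cond_eq_ite, decide_eq_true_eq] using this

namespace PolyDecidable

theorem eq_nil {l : α → List β} (hl : PolyTime l) : PolyDecidable fun a => l a = [] :=
  ⟨fun a => (l a).isEmpty, .list_cases (f₁ := fun _ => false) hl (.const true) (.const false)
    (fun a h => by simp [h]) (fun a b m h => by simp [h]), by simp⟩

theorem exists_mem {l : γ → List α} {P : γ → α → Prop} (hl : PolyTime l)
    (hP : PolyDecidable fun x : γ × α => P x.1 x.2) :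
    PolyDecidable fun c => ∃ a ∈ l c, P c a := by
  classical
  simpa [List.filter_eq_nil_iff] using (eq_nil (hl.filter hP)).not

theorem forall_mem {l : γ → List α} {P : γ → α → Prop} (hl : PolyTime l)
    (hP : PolyDecidable fun x : γ × α => P x.1 x.2) :
    PolyDecidable fun c => ∀ a ∈ l c, P c a := by
  simpa using (exists_mem (P := fun c a => ¬P c a) hl hP.not).not

end PolyDecidable

end PolyDecidable

/-! ### Equality of encoded values -/

/-- Push the encoding of `[b₁, …, bₙ]`, given `bₙ, …, b₁` from top to bottom on the stack `aux`. -/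
def encodeAux : BitProg :=
  seq (push main false) (loop aux fun b => pushAll (true :: bits b))

theorem runs_encodeAux (x m : List Bool) :
    Runs encodeAux (workStacks m x [] []) (onMain (bits x.reverse ++ m)) (6 * x.length + 2) := by
  have push_rest : ∀ l : List Bool,
      Runs (loop aux fun b => pushAll (true :: bits b) : BitProg)
        (workStacks (bits l ++ m) x [] []) (onMain (bits (x.reverse ++ l) ++ m))
        (6 * x.length + 1) := by
    induction x with
    | nil => exact fun l => .loop_nil rfl
    | cons b x ih =>
      intro l
      have hpush := runs_pushAll (true :: bits b) (bits l ++ m) (x := x) (z := []) (c := [])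
      have hrest := ih (b :: l)
      rw [bits_cons, List.cons_append, List.append_assoc, ← List.cons_append] at hrest
      rw [List.reverse_cons, List.append_assoc]
      refine (Runs.loop_cons rfl (by simpa using hpush) hrest).mono ?_
      have hb := size_bool_le b
      simp only [size, List.length_cons] at hb ⊢
      omega
  have h := (runs_push_main false m).seq (push_rest [])
  rw [List.append_nil] at h
  exact h.mono (by omega)

section Equality

variable {α γ : Type} [TreeEnc α] [TreeEnc γ]

theorem PolyTime.bits : PolyTime fun a : α => bits a := by
  refine ⟨seq moveTree encodeAux, 11 * X + 4, fun a m => ?_⟩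
  have h := (runs_moveTree a m [] []).seq (runs_encodeAux _ m)
  rw [List.append_nil, List.reverse_reverse] at h
  refine h.mono ?_
  simp only [size, List.length_reverse, eval_add, eval_mul, eval_X, eval_ofNat]
  omega

/-- Compare `s.2` with a list that is read from left to right: one step of the comparison, where
`s.1` records the absence of a difference so far. -/
def compareBit (s : Bool × List Bool) (a : Bool) : Bool × List Bool :=
  match s.2 with
  | [] => (false, [])
  | b :: l => (s.1 && (a == b), l)

theorem foldl_compareBit (l m : List Bool) (b : Bool) :
    l.foldl compareBit (b, m) = (true, []) ↔ b = true ∧ l = m := by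
  induction l generalizing m b with
  | nil => simp
  | cons a l ih => cases m <;> simp [compareBit, ih, and_assoc]

theorem size_compareBit_le (s : Bool × List Bool) (a : Bool) :
    size (compareBit s a) ≤ size s + 3 := by
  obtain ⟨b, _ | ⟨c, l⟩⟩ := s
  · have := size_pos b
    have : size false = 1 := rfl
    simp only [compareBit, size_pair, size_nil]
    omega
  · have := size_bool_le (b && (a == c))
    simp only [compareBit, size_pair, size_cons]
    omega

theorem PolyTime.bool_and {f g : α → Bool} (hf : PolyTime f) (hg : PolyTime g) :
    PolyTime fun a => f a && g a := by
  simpa only [Bool.cond_eq_ite, Bool.if_false_right, Bool.decide_eq_true] using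
    cond hf hg (.const false)

theorem PolyTime.bool_beq {f g : α → Bool} (hf : PolyTime f) (hg : PolyTime g) :
    PolyTime fun a => f a == g a := by
  convert cond hf hg (cond hg (.const false) (.const true)) using 2 with a
  cases f a <;> cases g a <;> rfl

theorem polyTime_compareBit :
    PolyTime fun p : (Bool × List Bool) × Bool => compareBit p.1 p.2 := by
  refine .list_cases (g := fun p : (Bool × List Bool) × Bool => p.1.2) (f₀ := fun _ => (false, []))
    (f₁ := fun q => (q.1.1.1 && (q.1.2 == q.2.1), q.2.2)) (by fun_prop) (.const _)
    (.prodMk (.bool_and (by fun_prop) (.bool_beq (by fun_prop) (by fun_prop))) (by fun_prop))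
    (fun p h => ?_) (fun p b l h => ?_) <;>
  rw [compareBit, h]

namespace PolyDecidable

theorem of_bool {f : α → Bool} (hf : PolyTime f) : PolyDecidable fun a => f a = true :=
  ⟨f, hf, fun _ => Iff.rfl⟩

theorem eq_of_bool_list {l m : γ → List Bool} (hl : PolyTime l) (hm : PolyTime m) :
    PolyDecidable fun c => l c = m c := by
  have hfold := PolyTime.foldl (f := fun _ => compareBit) hl ((PolyTime.const true).prodMk hm)
    (polyTime_compareBit.comp PolyTime.snd) 3 fun _ s a => by
      simpa using size_compareBit_le s a
  convert (of_bool (PolyTime.fst.comp hfold)).and (eq_nil (PolyTime.snd.comp hfold)) using 2 with c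
  have heq := foldl_compareBit (l c) (m c) true
  rw [Prod.ext_iff] at heq
  simpa using heq.symm

@[fun_prop]
theorem eq {f g : γ → α} (hf : PolyTime f) (hg : PolyTime g) :
    PolyDecidable fun c => f c = g c := by
  simpa only [bits_injective.eq_iff] using
    eq_of_bool_list (PolyTime.bits.comp hf) (PolyTime.bits.comp hg)

@[fun_prop]
theorem mem {f : γ → α} {l : γ → List α} (hf : PolyTime f) (hl : PolyTime l) :
    PolyDecidable fun c => f c ∈ l c := by
  simpa using exists_mem (P := fun c a => a = f c) hl (by fun_prop)

end PolyDecidable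

end Equality

/-! ### From polynomial-time predicates to the class P -/

/-- Programs over the work stacks and the input stack `none`. -/
abbrev InputProg (Γ : Type) : Type := Prog fun o : Option Work => o.elim Γ fun _ => Bool

theorem inP_of_runs {Γ : Type} [Fintype Γ] {L : Language Γ} {c : InputProg Γ} {p : ℕ[X]}
    (h : ∀ w b, (b = true ↔ w ∈ L) →
      Runs c (consStack w (onMain [])) (consStack [] (onMain [b])) (p.eval w.length)) :
    InP L := by
  classical
  have : ∀ o : Option Work, Fintype (o.elim Γ fun _ => Bool) := by
    rintro (_ | _) <;> dsimp only [Option.elim] <;> infer_instance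
  choose t ht hexec using fun w => h w (decide (w ∈ L)) (by simp)
  refine ⟨{ tm := c.toFinTM2 none (some main)
            inputAlphabet := Equiv.refl _
            outputAlphabet := Equiv.refl _
            time := p + 1
            outputsFun := fun w => { steps := t w + 1, evals_in_steps := ?_, steps_le_m := ?_ } }⟩
  · have halts := (hexec w).steps_toFinTM2 (k₀ := none) (k₁ := some main)
    have init_eq : ∀ w' : List Γ, w' = w → initList (c.toFinTM2 none (some main)) w' =
        ⟨some (some c.start), fun _ => none, consStack w (onMain [])⟩ := by
      rintro w rfl
      refine congrArg (TM2.Cfg.mk _ _) (funext ?_)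
      rintro (_ | _ | _ | _ | _) <;> rfl
    have halt_eq : ∀ b : Bool, haltList (c.toFinTM2 none (some main)) [b] =
        ⟨none, fun _ => none, consStack [] (onMain [b])⟩ := by
      intro b
      refine congrArg (TM2.Cfg.mk _ _) (funext ?_)
      rintro (_ | _ | _ | _ | _) <;> rfl
    rw [← init_eq _ (List.map_id w), ← halt_eq] at halts
    exact halts
  · simpa using ht w

section

variable {Γ : Type} [TreeEnc Γ]

/-- Push the encoding of the reversed input on the main stack. -/
def readInput (Γ : Type) [TreeEnc Γ] : InputProg Γ :=
  seq (addStack Γ (push main false))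
    (loop none fun s : Γ => addStack Γ (pushAll (true :: bits s)))

theorem runs_readInput {N : ℕ} (hN : ∀ s : Γ, size s ≤ N) (w : List Γ) :
    Runs (readInput Γ) (consStack w (onMain [])) (consStack [] (onMain (bits w.reverse)))
      ((N + 3) * w.length + 2) := by
  have push_symbols : ∀ l : List Γ,
      Runs (loop none fun s : Γ => addStack Γ (pushAll (true :: bits s)) : InputProg Γ)
        (consStack w (onMain (bits l))) (consStack [] (onMain (bits (w.reverse ++ l))))
        ((N + 3) * w.length + 1) := by
    induction w with
    | nil => exact fun l => .loop_nil rfl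
    | cons s w ih =>
      intro l
      have hpush := (runs_pushAll (true :: bits s) (bits l) (x := []) (z := [])
        (c := [])).addStack w
      rw [← update_consStack_none (s :: w)] at hpush
      rw [List.reverse_cons, List.append_assoc]
      refine (Runs.loop_cons (k := none) rfl hpush (ih (s :: l))).mono ?_
      have hs := hN s
      simp only [size, List.length_cons, mul_add] at hs ⊢
      omega
  have h := ((runs_push_main false []).addStack w).seq (push_symbols [])
  rw [List.append_nil] at h
  exact h.mono (by omega)

/-- Replace the encoding of a truth value by the truth value. -/
def decodeBool : BitProg :=
  case main fun
    | some true => case main fun _ => case main fun _ => push main true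
    | _ => push main false

theorem runs_decodeBool (b : Bool) : Runs decodeBool (onMain (bits b)) (onMain [b]) 4 := by
  cases b with
  | false => exact (runs_case_main (runs_push_main false [])).mono (by omega)
  | true => exact runs_case_main (runs_case_main (runs_case_main (runs_push_main true [])))

theorem size_le_of_forall_size_le {N : ℕ} (hN : ∀ s : Γ, size s ≤ N) (w : List Γ) :
    size w ≤ (N + 1) * w.length + 1 := by
  induction w with
  | nil => rfl
  | cons s w ih =>
    have := hN s
    simp only [size_cons, List.length_cons, mul_add]
    omega

theorem inP_of_polyDecidable [Fintype Γ] {L : Language Γ} (h : PolyDecidable fun w => w ∈ L) :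
    InP L := by
  obtain ⟨N, hN⟩ : ∃ N, ∀ s : Γ, size s ≤ N :=
    ⟨Finset.univ.sup size, fun s => Finset.le_sup (Finset.mem_univ s)⟩
  obtain ⟨f, ⟨c, p, hc⟩, hf⟩ := h.comp (PolyTime.id.reverse)
  refine inP_of_runs (c := seq (readInput Γ) (addStack Γ (seq c decodeBool)))
    (p := C (N + 3) * X + 6 + p.comp (C (N + 1) * X + 1)) fun w b hb => ?_
  have hfw : f w.reverse = b := by
    refine Bool.eq_iff_iff.2 ((hf w.reverse).trans ?_)
    simp only [List.reverse_reverse, hb]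
  have hdecide := hc w.reverse []
  rw [List.append_nil, List.append_nil, hfw] at hdecide
  refine ((runs_readInput hN w).seq ((hdecide.seq (runs_decodeBool b)).addStack [])).mono ?_
  have := eval_mono p (size_le_of_forall_size_le hN w.reverse)
  simp only [List.length_reverse, eval_add, eval_mul, eval_comp, eval_X, eval_C, eval_one,
    eval_ofNat] at this ⊢
  omega

end

/-! ### Transitive closure -/

open Relation

section TransClosure

variable {α : Type} [DecidableEq α] {U : List α} {E : List (α × α)} {k m x y : α}

/-- Add to the relation `E` on `U` the pairs connected through `k`, the step of Warshall's
algorithm. -/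
def connect (U : List α) (E : List (α × α)) (k : α) : List (α × α) :=
  (U ×ˢ U).filter fun p => p ∈ E ∨ (p.1, k) ∈ E ∧ (k, p.2) ∈ E

/-- The relation `E` is transitive at the intermediate point `k`. -/
def TransThrough (E : List (α × α)) (k : α) : Prop :=
  ∀ ⦃x y⦄, (x, k) ∈ E → (k, y) ∈ E → (x, y) ∈ E

theorem connect_subset : connect U E k ⊆ U ×ˢ U :=
  List.filter_sublist.subset

theorem mem_connect (hE : E ⊆ U ×ˢ U) :
    (x, y) ∈ connect U E k ↔ (x, y) ∈ E ∨ (x, k) ∈ E ∧ (k, y) ∈ E := by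
  simp only [connect, List.mem_filter, decide_eq_true_eq, and_iff_right_iff_imp]
  rintro (h | ⟨hx, hy⟩)
  · exact hE h
  · exact List.mem_product.2 ⟨(List.mem_product.1 (hE hx)).1, (List.mem_product.1 (hE hy)).2⟩

theorem subset_connect (hE : E ⊆ U ×ˢ U) : E ⊆ connect U E k :=
  fun _ h => (mem_connect hE).2 (.inl h)

theorem transThrough_connect_self (hE : E ⊆ U ×ˢ U) : TransThrough (connect U E k) k := by
  intro x y hx hy
  simp only [mem_connect hE] at *
  tauto

theorem TransThrough.connect (h : TransThrough E m) (hE : E ⊆ U ×ˢ U) :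
    TransThrough (connect U E k) m := by
  intro x y hx hy
  rw [mem_connect hE] at *
  rcases hx with hx | ⟨hxk, hkm⟩ <;> rcases hy with hy | ⟨hmk, hky⟩
  · exact .inl (h hx hy)
  · exact .inr ⟨h hx hmk, hky⟩
  · exact .inr ⟨hxk, h hkm hy⟩
  · exact .inr ⟨hxk, hky⟩

theorem TransThrough.foldl_connect (h : TransThrough E m) (hE : E ⊆ U ×ˢ U) (ks : List α) :
    TransThrough (ks.foldl (KromImp.connect U) E) m := by
  induction ks generalizing E with
  | nil => exact h
  | cons k _ ih => exact ih (h.connect hE) connect_subset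

theorem transThrough_foldl_connect {ks : List α} (hk : k ∈ ks) (hE : E ⊆ U ×ˢ U) :
    TransThrough (ks.foldl (connect U) E) k := by
  induction ks generalizing E with
  | nil => simp at hk
  | cons m ks ih =>
    obtain rfl | hk := List.mem_cons.1 hk
    · exact (transThrough_connect_self hE).foldl_connect connect_subset ks
    · exact ih hk connect_subset

theorem subset_foldl_connect (hE : E ⊆ U ×ˢ U) (ks : List α) : E ⊆ ks.foldl (connect U) E := by
  induction ks generalizing E with
  | nil => exact List.Subset.refl E
  | cons k ks ih => exact List.Subset.trans (subset_connect hE) (ih connect_subset)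

theorem transGen_of_mem_foldl_connect {R : α → α → Prop} (hE : E ⊆ U ×ˢ U)
    (hR : ∀ x y, (x, y) ∈ E → TransGen R x y) {ks : List α}
    (h : (x, y) ∈ ks.foldl (connect U) E) : TransGen R x y := by
  induction ks generalizing E with
  | nil => exact hR x y h
  | cons k ks ih =>
    refine ih connect_subset (fun a b hab => ?_) h
    obtain hab | ⟨hak, hkb⟩ := (mem_connect hE).1 hab
    · exact hR a b hab
    · exact (hR a k hak).trans (hR k b hkb)

/-- The points related by `E`. -/
def vertices (E : List (α × α)) : List α := E.map Prod.fst ++ E.map Prod.snd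

/-- The transitive closure of a finite relation, by Warshall's algorithm. -/
def transClosure (E : List (α × α)) : List (α × α) :=
  (vertices E).foldl (connect (vertices E)) E

theorem mem_transClosure : (x, y) ∈ transClosure E ↔ TransGen (fun a b => (a, b) ∈ E) x y := by
  have fst_mem : ∀ {a b}, (a, b) ∈ E → a ∈ vertices E := fun h =>
    List.mem_append_left _ (List.mem_map_of_mem h)
  have snd_mem : ∀ {a b}, (a, b) ∈ E → b ∈ vertices E := fun h =>
    List.mem_append_right _ (List.mem_map_of_mem h)
  have hE : E ⊆ vertices E ×ˢ vertices E := fun _ h =>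
    List.mem_product.2 ⟨fst_mem h, snd_mem h⟩
  refine ⟨transGen_of_mem_foldl_connect hE fun _ _ => TransGen.single (r := fun a b => (a, b) ∈ E),
    fun h => ?_⟩
  induction h with
  | single h => exact subset_foldl_connect hE _ h
  | tail _ h ih => exact transThrough_foldl_connect (fst_mem h) hE ih (subset_foldl_connect hE _ h)

theorem PolyTime.vertices {β : Type} [TreeEnc β] :
    PolyTime (vertices : List (β × β) → List β) :=
  append (map (f := fun _ => Prod.fst) id (fst.comp snd))
    (map (f := fun _ => Prod.snd) id (snd.comp snd))

@[fun_prop]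
theorem PolyTime.transClosure [TreeEnc α] :
    PolyTime (transClosure : List (α × α) → List (α × α)) := by
  have hconnect : PolyTime fun p : List (α × α) × List (α × α) × α =>
      connect (KromImp.vertices p.1) p.2.1 p.2.2 :=
    filter (product (vertices.comp fst) (vertices.comp fst)) (by fun_prop)
  obtain ⟨q, hq⟩ := (product (vertices (β := α)) vertices).exists_size_le
  refine foldl vertices id hconnect q fun E F k => ?_
  calc size (connect (KromImp.vertices E) F k)
      ≤ size (KromImp.vertices E ×ˢ KromImp.vertices E) := size_le_of_sublist List.filter_sublist
    _ ≤ q.eval (size E) := hq E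
    _ ≤ size F + q.eval (size E + size k) :=
      (eval_mono q (Nat.le_add_right _ _)).trans (Nat.le_add_left _ _)

end TransClosure

/-! ### Satisfiability of Krom formulas -/

theorem exists_closed_of_forall_not_cycle {V : Type*} {r : V → V → Prop} {neg : V → V}
    (hneg : Function.Involutive neg) (hr : ∀ x y, r x y → r (neg y) (neg x))
    (hc : ∀ x, ReflTransGen r x (neg x) → ¬ReflTransGen r (neg x) x) :
    ∃ T : Set V, (∀ x y, x ∈ T → r x y → y ∈ T) ∧ ∀ x, neg x ∈ T ↔ x ∉ T := by
  have contrapose : ∀ {x y}, ReflTransGen r x y → ReflTransGen r (neg y) (neg x) :=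
    fun h => reflTransGen_swap.1 (h.lift neg fun a b hab => hr a b hab)
  obtain ⟨T, ⟨hclosed, hconsistent⟩, hmax⟩ := zorn_subset
    {T : Set V | (∀ x y, x ∈ T → ReflTransGen r x y → y ∈ T) ∧ ∀ x ∈ T, neg x ∉ T} (by
      intro C hC hchain
      refine ⟨⋃₀ C, ⟨?_, ?_⟩, fun _ => Set.subset_sUnion_of_mem⟩
      · rintro x y ⟨A, hA, hx⟩ hxy
        exact ⟨A, hA, (hC hA).1 x y hx hxy⟩
      · rintro x ⟨A, hA, hx⟩ ⟨B, hB, hx'⟩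
        rcases hchain.total hA hB with h | h
        · exact (hC hB).2 x (h hx) hx'
        · exact (hC hA).2 x hx (h hx'))
  have extend : ∀ x, ¬ReflTransGen r x (neg x) → neg x ∉ T → x ∈ T := by
    intro x hx hxT
    refine hmax (y := T ∪ {y | ReflTransGen r x y}) ⟨?_, ?_⟩ Set.subset_union_left (.inr .refl)
    · rintro y z (hy | hy) hyz
      · exact .inl (hclosed y z hy hyz)
      · exact .inr (ReflTransGen.trans hy hyz)
    · rintro y (hy | hy) (hy' | hy')
      · exact hconsistent y hy hy'
      · exact hxT (hclosed y _ hy (by simpa only [hneg y] using contrapose hy'))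
      · exact hxT (hclosed _ _ hy' (contrapose hy))
      · exact hx (ReflTransGen.trans hy (by simpa only [hneg y] using contrapose hy'))
  refine ⟨T, fun x y hx hxy => hclosed x y hx (.single hxy),
    fun x => ⟨fun h h' => hconsistent x h' h, fun hx => ?_⟩⟩
  by_contra hnx
  by_cases hcx : ReflTransGen r x (neg x)
  · exact hnx (extend (neg x) (by simpa only [hneg x] using hc x hcx) (by simpa only [hneg x]))
  · exact hx (extend x hcx hnx)

theorem exists_eq_pair {α : Type*} [DecidableEq α] {s : Finset α} (hs : s.Nonempty)
    (hcard : s.card ≤ 2) : ∃ a b, s = {a, b} := by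
  obtain hone | htwo : s.card = 1 ∨ s.card = 2 := by
    have := hs.card_pos
    omega
  · obtain ⟨a, rfl⟩ := Finset.card_eq_one.1 hone
    exact ⟨a, a, by simp⟩
  · obtain ⟨a, b, -, rfl⟩ := Finset.card_eq_two.1 htwo
    exact ⟨a, b, rfl⟩

/-- The complementary literal. -/
def Literal.neg (ℓ : Literal) : Literal := ⟨ℓ.var, !ℓ.positive⟩

@[simp] theorem Literal.neg_neg (ℓ : Literal) : ℓ.neg.neg = ℓ := by
  simp [Literal.neg]

theorem Literal.neg_ne (ℓ : Literal) : ℓ.neg ≠ ℓ := fun h => by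
  simpa [Literal.neg] using congrArg Literal.positive h

@[simp] theorem Literal.eval_neg (θ : Assignment) (ℓ : Literal) : ℓ.neg.eval θ = !ℓ.eval θ := by
  rcases ℓ with ⟨v, _ | _⟩ <;> simp [Literal.neg, Literal.eval]

theorem exists_assignment_of_neg_mem_iff {T : Set Literal} (hT : ∀ x, x.neg ∈ T ↔ x ∉ T) :
    ∃ θ : Assignment, ∀ x, x.eval θ = true ↔ x ∈ T := by
  classical
  refine ⟨fun v => decide (⟨v, true⟩ ∈ T), ?_⟩
  rintro ⟨v, _ | _⟩
  · simpa [Literal.eval, Literal.neg] using (hT ⟨v, true⟩).symm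
  · simp [Literal.eval]

/-- The edges `x ⟶ y` of the implication graph of a Krom formula come from its clauses
`¬x ∨ y`. -/
def Implication (φ : CNF) (x y : Literal) : Prop := ({x.neg, y} : Clause) ∈ φ

section Implication

variable {φ : CNF} {θ : Assignment} {x y : Literal}

theorem Implication.contrapose (h : Implication φ x y) : Implication φ y.neg x.neg := by
  rwa [Implication, Literal.neg_neg, Finset.pair_comm]

theorem Implication.eval (h : Implication φ x y) (hθ : CNF.SatisfiedBy φ θ)
    (hx : x.eval θ = true) : y.eval θ = true := by
  simpa [Clause.SatisfiedBy, hx] using hθ _ h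

theorem eval_of_transGen_implication (h : TransGen (Implication φ) x y)
    (hθ : CNF.SatisfiedBy φ θ) (hx : x.eval θ = true) : y.eval θ = true := by
  induction h with
  | single h => exact h.eval hθ hx
  | tail _ h ih => exact h.eval hθ ih

theorem satisfiedBy_of_implication_closed (hφ : φ ∈ krom) (hempty : ∅ ∉ φ)
    (h : ∀ x y, Implication φ x y → x.eval θ = true → y.eval θ = true) :
    CNF.SatisfiedBy φ θ := by
  intro C hC
  have hne : C ≠ ∅ := fun h => hempty (h ▸ hC)
  obtain ⟨a, b, rfl⟩ := exists_eq_pair (Finset.nonempty_iff_ne_empty.2 hne) (hφ C hC)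
  by_cases ha : a.eval θ = true
  · exact ⟨a, by simp, ha⟩
  · exact ⟨b, by simp, h a.neg b (by simpa [Implication] using hC) (by simpa using ha)⟩

theorem exists_satisfiedBy_iff (hφ : φ ∈ krom) :
    (∃ θ, CNF.SatisfiedBy φ θ) ↔ ∅ ∉ φ ∧
      ∀ x, TransGen (Implication φ) x x.neg → ¬TransGen (Implication φ) x.neg x := by
  constructor
  · rintro ⟨θ, hθ⟩
    refine ⟨fun h => by simpa [Clause.SatisfiedBy] using hθ ∅ h, fun x h h' => ?_⟩
    have hx := eval_of_transGen_implication h hθ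
    have hnx := eval_of_transGen_implication h' hθ
    rw [Literal.eval_neg] at hx hnx
    cases hxθ : x.eval θ <;> simp [hxθ] at hx hnx
  · rintro ⟨hempty, hcycle⟩
    obtain ⟨T, hclosed, hT⟩ := exists_closed_of_forall_not_cycle
      (r := Implication φ) Literal.neg_neg (fun _ _ => Implication.contrapose) (by
        intro x h h'
        rw [reflTransGen_iff_eq_or_transGen] at h h'
        exact hcycle x (h.resolve_left x.neg_ne) (h'.resolve_left x.neg_ne.symm))
    obtain ⟨θ, hθ⟩ := exists_assignment_of_neg_mem_iff hT
    refine ⟨θ, satisfiedBy_of_implication_closed hφ hempty fun x y hxy hx => ?_⟩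
    rw [hθ] at *
    exact hclosed x y hx hxy

end Implication

/-! ### The implication problem on parsed instances -/

/-- The edges of the implication graph of a list of clauses. -/
def implications (S : List (List Literal)) : List (Literal × Literal) :=
  S.flatMap fun c => ((c ×ˢ c).filter fun p => ∀ ℓ ∈ c, ℓ = p.1 ∨ ℓ = p.2).map
    fun p => (p.1.neg, p.2)

/-- A syntactic certificate of unsatisfiability of a list of Krom clauses: the empty clause, or a
cycle of implications through complementary literals. -/
def Contradictory (S : List (List Literal)) : Prop :=
  [] ∈ S ∨ ∃ e ∈ transClosure (implications S), e.2 = e.1.neg ∧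
    (e.2, e.1) ∈ transClosure (implications S)

/-- The clause enumerated by `c` has at most two literals. -/
def IsKromClause (c : List Literal) : Prop :=
  ∀ x ∈ c, ∀ y ∈ c, ∀ z ∈ c, x = y ∨ x = z ∨ y = z

/-- The clauses of the formulas of `p` together with the negation of the clause `c`; they are
jointly unsatisfiable exactly if `p` entails `c`. -/
def refutationClauses (p : List (List (List Literal))) (c : List Literal) : List (List Literal) :=
  p.flatten ++ c.map fun ℓ => [ℓ.neg]

/-- The purely syntactic form of the implication problem for Krom formulas. -/
def KromImplication (p : List (List (List Literal))) (f : List (List Literal)) : Prop :=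
  (∀ c ∈ p.flatten ++ f, IsKromClause c) ∧ ∀ c ∈ f, Contradictory (refutationClauses p c)

theorem toFinset_eq_pair_iff {α : Type*} [DecidableEq α] {c : List α} {a b : α} :
    c.toFinset = {a, b} ↔ a ∈ c ∧ b ∈ c ∧ ∀ ℓ ∈ c, ℓ = a ∨ ℓ = b := by
  simp only [Finset.Subset.antisymm_iff, Finset.subset_iff, List.mem_toFinset, Finset.mem_insert,
    Finset.mem_singleton, forall_eq_or_imp, forall_eq]
  tauto

theorem mem_implications {S : List (List Literal)} {x y : Literal} :
    (x, y) ∈ implications S ↔ Implication (toCNF S) x y := by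
  simp only [implications, Implication, toCNF, List.mem_flatMap, List.mem_map, List.mem_filter,
    List.mem_toFinset, toFinset_eq_pair_iff, Prod.exists, Prod.mk.injEq, List.mem_product,
    decide_eq_true_eq]
  refine exists_congr fun c => and_congr_right fun _ => ?_
  constructor
  · rintro ⟨a, b, h, rfl, rfl⟩
    simpa [and_assoc] using h
  · exact fun h => ⟨x.neg, y, by simpa [and_assoc] using h, x.neg_neg, rfl⟩

theorem contradictory_iff {S : List (List Literal)} (hS : toCNF S ∈ krom) :
    Contradictory S ↔ ∀ θ, ¬CNF.SatisfiedBy (toCNF S) θ := by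
  have empty_mem : ∅ ∈ toCNF S ↔ [] ∈ S := by simp [toCNF]
  have h := (exists_satisfiedBy_iff hS).not
  simp only [Contradictory, mem_transClosure, mem_implications, Prod.exists]
  rw [← not_exists, h, empty_mem]
  simp only [not_and_or, not_not, not_forall, exists_prop]
  simp

theorem toCNF_mem_krom {f : List (List Literal)} :
    toCNF f ∈ krom ↔ ∀ c ∈ f, IsKromClause c := by
  simp only [krom, toCNF, Set.mem_ofPred_eq, List.mem_toFinset, List.forall_mem_map]
  refine forall₂_congr fun c _ => ?_
  rw [← not_lt, Finset.two_lt_card]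
  simp only [IsKromClause, List.mem_toFinset]
  push Not
  grind

theorem toCNF_satisfiedBy {f : List (List Literal)} {θ : Assignment} :
    CNF.SatisfiedBy (toCNF f) θ ↔ ∀ c ∈ f, ∃ ℓ ∈ c, ℓ.eval θ = true := by
  simp [CNF.SatisfiedBy, Clause.SatisfiedBy, toCNF]

theorem toPremises_satisfiedBy {p : List (List (List Literal))} {θ : Assignment} :
    (∀ φ ∈ toPremises p, CNF.SatisfiedBy φ θ) ↔ CNF.SatisfiedBy (toCNF p.flatten) θ := by
  simp only [toPremises, List.mem_toFinset, List.forall_mem_map, toCNF_satisfiedBy,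
    List.forall_mem_flatten]

theorem toPremises_subset_krom {p : List (List (List Literal))} :
    (toPremises p : Set CNF) ⊆ krom ↔ ∀ c ∈ p.flatten, IsKromClause c := by
  simp only [toPremises, Set.subset_def, Finset.mem_coe, List.mem_toFinset, List.forall_mem_map,
    toCNF_mem_krom, List.forall_mem_flatten]

theorem refutationClauses_satisfiedBy {p : List (List (List Literal))} {c : List Literal}
    {θ : Assignment} :
    CNF.SatisfiedBy (toCNF (refutationClauses p c)) θ ↔
      CNF.SatisfiedBy (toCNF p.flatten) θ ∧ ¬∃ ℓ ∈ c, ℓ.eval θ = true := by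
  simp only [toCNF_satisfiedBy, refutationClauses, List.forall_mem_append, List.forall_mem_map]
  simp

theorem entails_iff {p : List (List (List Literal))} {f : List (List Literal)} :
    Entails (toPremises p) (toCNF f) ↔
      ∀ c ∈ f, ∀ θ, ¬CNF.SatisfiedBy (toCNF (refutationClauses p c)) θ := by
  simp only [Entails, toPremises_satisfiedBy, refutationClauses_satisfiedBy, not_and, not_not]
  simp only [toCNF_satisfiedBy (f := f)]
  exact ⟨fun h c hc θ hθ => h θ hθ c hc, fun h θ hθ c hc => h c hc θ hθ⟩

theorem isKromClause_of_mem_refutationClauses {p : List (List (List Literal))} {c d : List Literal}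
    (hp : ∀ d ∈ p.flatten, IsKromClause d) (hd : d ∈ refutationClauses p c) : IsKromClause d := by
  rcases List.mem_append.1 hd with hd | hd
  · exact hp d hd
  · obtain ⟨ℓ, -, rfl⟩ := List.mem_map.1 hd
    simp [IsKromClause]

theorem kromImplication_iff {p : List (List (List Literal))} {f : List (List Literal)} :
    KromImplication p f ↔
      (toPremises p : Set CNF) ⊆ krom ∧ toCNF f ∈ krom ∧ Entails (toPremises p) (toCNF f) := by
  rw [KromImplication, List.forall_mem_append, toPremises_subset_krom, toCNF_mem_krom, entails_iff,
    and_assoc]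
  refine and_congr_right fun hp => and_congr_right fun _ => forall₂_congr fun c _ => ?_
  exact contradictory_iff (toCNF_mem_krom.2 fun d => isKromClause_of_mem_refutationClauses hp)

instance : TreeEnc Literal where
  enc ℓ := enc (ℓ.var, ℓ.positive)
  enc_injective := by
    rintro ⟨v, b⟩ ⟨w, c⟩ h
    simpa using enc_injective h

section PolyTime

variable {α : Type} [TreeEnc α]

namespace PolyTime

@[fun_prop]
theorem literal_var {f : α → Literal} (hf : PolyTime f) : PolyTime fun a => (f a).var :=
  comp (g := fun p : PVar × Bool => p.1) fst
    (comp (g := fun ℓ : Literal => (ℓ.var, ℓ.positive)) (of_enc_eq fun _ => rfl) hf)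

@[fun_prop]
theorem literal_positive {f : α → Literal} (hf : PolyTime f) : PolyTime fun a => (f a).positive :=
  comp (g := fun p : PVar × Bool => p.2) snd
    (comp (g := fun ℓ : Literal => (ℓ.var, ℓ.positive)) (of_enc_eq fun _ => rfl) hf)

@[fun_prop]
theorem literal_mk {f : α → PVar} {g : α → Bool} (hf : PolyTime f) (hg : PolyTime g) :
    PolyTime fun a => Literal.mk (f a) (g a) :=
  comp (g := fun p : PVar × Bool => Literal.mk p.1 p.2) (of_enc_eq fun _ => rfl) (hf.prodMk hg)

@[fun_prop]
theorem bool_not {f : α → Bool} (hf : PolyTime f) : PolyTime fun a => !f a := by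
  simpa using bool_beq hf (const false)

@[fun_prop]
theorem literal_neg {f : α → Literal} (hf : PolyTime f) : PolyTime fun a => (f a).neg := by
  unfold Literal.neg
  fun_prop

@[fun_prop]
theorem implications : PolyTime implications := by
  refine flatMap id (map (filter (P := fun (x : List (List Literal) × List Literal)
    (p : Literal × Literal) => ∀ ℓ ∈ x.2, ℓ = p.1 ∨ ℓ = p.2) ?_ ?_) ?_)
  · fun_prop
  · exact .forall_mem (by fun_prop) (by fun_prop)
  · fun_prop

@[fun_prop]
theorem refutationClauses {p : α → List (List (List Literal))} {c : α → List Literal}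
    (hp : PolyTime p) (hc : PolyTime c) : PolyTime fun a => refutationClauses (p a) (c a) :=
  append (by fun_prop) (map (f := fun _ (ℓ : Literal) => [ℓ.neg]) hc (by fun_prop))

end PolyTime

namespace PolyDecidable

@[fun_prop]
theorem contradictory : PolyDecidable Contradictory :=
  or (by fun_prop) <|
    exists_mem (P := fun S (e : Literal × Literal) => e.2 = e.1.neg ∧
      (e.2, e.1) ∈ transClosure (implications S))
      (by fun_prop) (by fun_prop)

@[fun_prop]
theorem isKromClause : PolyDecidable IsKromClause :=
  forall_mem .id <| forall_mem .fst <| forall_mem (by fun_prop) (by fun_prop)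

@[fun_prop]
theorem kromImplication {p : α → List (List (List Literal))} {f : α → List (List Literal)}
    (hp : PolyTime p) (hf : PolyTime f) : PolyDecidable fun a => KromImplication (p a) (f a) :=
  and (forall_mem (P := fun _ => IsKromClause) (by fun_prop) (by fun_prop)) <|
    forall_mem (P := fun a c => Contradictory (refutationClauses (p a) c)) hf (by fun_prop)

end PolyDecidable

end PolyTime

/-! ### Decoding words over the input alphabet -/

/-- An injective code of the symbols of the input alphabet. -/
def Symbol.code : Symbol → List Bool
  | .bit b => [b]
  | .pos => [true, true]
  | .neg => [true, false]
  | .endClause => [false, true]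
  | .endFormula => [false, false]
  | .turnstile => []

instance : TreeEnc Symbol where
  enc s := enc s.code
  enc_injective := enc_injective.comp (by decide : Function.Injective Symbol.code)

/-- The formulas to the right of the last turnstile read, and those on its left read so far. -/
abbrev ParseState : Type := List (List (List Literal)) × List (List (List Literal))

/-- Prepend a bit to the name of the variable of a literal. -/
def Literal.consBit (b : Bool) (ℓ : Literal) : Literal := ⟨b :: ℓ.var, ℓ.positive⟩

/-- Extend the parsed part of a word by one symbol to the left. The result is meaningful on
encodings of instances only: words that are not encodings are not detected here. -/
def parseSymbol (st : ParseState) : Symbol → ParseState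
  | .turnstile => (st.2, [])
  | .endFormula => (st.1, [] :: st.2)
  | .endClause => (st.1, st.2.modifyHead ([] :: ·))
  | .pos => (st.1, st.2.modifyHead (List.modifyHead (⟨[], true⟩ :: ·)))
  | .neg => (st.1, st.2.modifyHead (List.modifyHead (⟨[], false⟩ :: ·)))
  | .bit b => (st.1, st.2.modifyHead (List.modifyHead (List.modifyHead (Literal.consBit b))))

/-- Parse a word from right to left. -/
def parse (w : List Symbol) (st : ParseState) : ParseState :=
  w.foldr (fun s st => parseSymbol st s) st

theorem parse_append (v w : List Symbol) (st : ParseState) :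
    parse (v ++ w) st = parse v (parse w st) :=
  List.foldr_append

theorem parse_flatMap {α : Type*} {e : α → List Symbol} {state : List α → ParseState}
    (he : ∀ a l, parse (e a) (state l) = state (a :: l)) (l m : List α) :
    parse (l.flatMap e) (state m) = state (l ++ m) := by
  induction l with
  | nil => rfl
  | cons a l ih => rw [List.flatMap_cons, parse_append, ih, he, List.cons_append]

theorem parse_encodeLiteral (ℓ : Literal) (x : List (List (List Literal))) (c : List Literal)
    (φ : List (List Literal)) (l : List (List (List Literal))) :
    parse (encodeLiteral ℓ) (x, (c :: φ) :: l) = (x, ((ℓ :: c) :: φ) :: l) := by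
  obtain ⟨v, b⟩ := ℓ
  induction v with
  | nil => cases b <;> rfl
  | cons d v ih => exact congrArg (parseSymbol · (.bit d)) ih

theorem parse_encodeClause (c : List Literal) (x : List (List (List Literal)))
    (φ : List (List Literal)) (l : List (List (List Literal))) :
    parse (encodeClause c) (x, φ :: l) = (x, (c :: φ) :: l) := by
  have := parse_flatMap (state := fun c => (x, (c :: φ) :: l))
    (fun ℓ c => parse_encodeLiteral ℓ x c φ l) c []
  rw [List.append_nil] at this
  rwa [encodeClause, parse_append]

theorem parse_encodeFormula (φ : List (List Literal)) (x l : List (List (List Literal))) :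
    parse (encodeFormula φ) (x, l) = (x, φ :: l) := by
  have := parse_flatMap (state := fun φ => (x, φ :: l))
    (fun c φ => parse_encodeClause c x φ l) φ []
  rw [List.append_nil] at this
  rwa [encodeFormula, parse_append]

theorem parse_encodeInstance (p : List (List (List Literal))) (f : List (List Literal)) :
    parse (encodeInstance p f) ([], []) = ([f], p) := by
  have := parse_flatMap (state := fun p => ([f], p))
    (fun φ p => parse_encodeFormula φ [f] p) p []
  rw [List.append_nil] at this
  rwa [encodeInstance, parse_append, parse_append, parse_encodeFormula]

theorem mem_IMP_krom_iff {w : List Symbol} :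
    w ∈ IMP krom ↔ ∃ f ∈ (parse w ([], [])).1,
      encodeInstance (parse w ([], [])).2 f = w ∧ KromImplication (parse w ([], [])).2 f := by
  constructor
  · rintro ⟨_, _, ⟨p, f, rfl, rfl, rfl⟩, h⟩
    rw [parse_encodeInstance]
    exact ⟨f, List.mem_singleton_self f, rfl, kromImplication_iff.2 h⟩
  · rintro ⟨f, -, hw, h⟩
    exact ⟨_, _, ⟨_, f, rfl, rfl, hw⟩, kromImplication_iff.1 h⟩

namespace PolyTime

section

variable {α β γ σ : Type} [TreeEnc α] [TreeEnc β] [TreeEnc γ] [TreeEnc σ]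

theorem finite_cases [Finite σ] {f : α → σ → β} (hf : ∀ s, PolyTime fun a => f a s) :
    PolyTime fun p : α × σ => f p.1 p.2 := by
  classical
  obtain h | ⟨⟨s₀⟩⟩ := isEmpty_or_nonempty σ
  · exact of_enc_eq fun p => isEmptyElim p.2
  have agree_on : ∀ l : List σ, ∃ g : α × σ → β, PolyTime g ∧ ∀ a, ∀ s ∈ l, g (a, s) = f a s := by
    intro l
    induction l with
    | nil => exact ⟨fun p => f p.1 s₀, (hf s₀).comp fst, by simp⟩
    | cons t l ih =>
      obtain ⟨g, hg, hgf⟩ := ih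
      refine ⟨fun p => if p.2 = t then f p.1 t else g p,
        ite (by fun_prop) ((hf t).comp fst) hg, fun a s hs => ?_⟩
      dsimp only
      split_ifs with hst
      · rw [hst]
      · exact hgf a s (List.mem_of_ne_of_mem hst hs)
  obtain ⟨l, hl⟩ := Finite.exists_univ_list σ
  obtain ⟨g, hg, hgf⟩ := agree_on l
  simpa only [← hgf _ _ (hl.2 _)] using hg

theorem of_finite [Finite σ] (f : σ → β) : PolyTime f :=
  (finite_cases fun s => const (α := Bool) (f s)).comp ((const true).prodMk id)

theorem modifyHead {l : γ → List α} {f : γ → α → α} (hl : PolyTime l)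
    (hf : PolyTime fun p : γ × α => f p.1 p.2) : PolyTime fun c => (l c).modifyHead (f c) :=
  list_cases (f₁ := fun p : γ × α × List α => f p.1 p.2.1 :: p.2.2) hl (const []) (by fun_prop)
    (fun c h => by simp [h]) (fun c a m h => by simp [h])

end

@[fun_prop]
theorem parseSymbol : PolyTime fun p : ParseState × Symbol => parseSymbol p.1 p.2 := by
  refine finite_cases ?_
  rintro (b | _ | _ | _ | _ | _)
  · refine prodMk fst (modifyHead snd (modifyHead snd (modifyHead snd ?_)))
    unfold Literal.consBit
    fun_prop
  · exact prodMk fst (modifyHead snd (modifyHead snd (by fun_prop)))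
  · exact prodMk fst (modifyHead snd (modifyHead snd (by fun_prop)))
  · exact prodMk fst (modifyHead snd (by fun_prop))
  · exact prodMk fst (by fun_prop)
  · exact prodMk snd (const [])

end PolyTime

theorem size_modifyHead_le {α : Type} [TreeEnc α] {f : α → α} {k : ℕ}
    (hf : ∀ a, size (f a) ≤ size a + k) (l : List α) : size (l.modifyHead f) ≤ size l + k := by
  cases l with
  | nil => simp
  | cons a l =>
    have := hf a
    simp only [List.modifyHead_cons, size_cons]
    omega

theorem size_cons_le_add {α : Type} [TreeEnc α] {a : α} {k : ℕ} (ha : size a < k) (l : List α) :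
    size (a :: l) ≤ size l + k := by
  rw [size_cons]
  omega

theorem size_consBit_le (b : Bool) (ℓ : Literal) : size (ℓ.consBit b) ≤ size ℓ + 6 := by
  have h : ∀ ℓ : Literal, size ℓ = size (ℓ.var, ℓ.positive) := fun _ => rfl
  have hb := size_bool_le b
  simp only [h, Literal.consBit, size_pair, size_cons]
  omega

theorem size_parseSymbol_le (st : ParseState) (s : Symbol) :
    size (parseSymbol st s) ≤ size st + 6 := by
  have hst : size st = size st.1 + size st.2 + 1 := size_pair st.1 st.2
  have snd_le : ∀ {l : List (List (List Literal))}, size l ≤ size st.2 + 6 →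
      size (st.1, l) ≤ size st + 6 := by
    intro l hl
    rw [size_pair, hst]
    omega
  rcases s with b | _ | _ | _ | _ | _
  · exact snd_le <| size_modifyHead_le (size_modifyHead_le (size_modifyHead_le
      (size_consBit_le b))) _
  · exact snd_le <| size_modifyHead_le (size_modifyHead_le (size_cons_le_add (by decide))) _
  · exact snd_le <| size_modifyHead_le (size_modifyHead_le (size_cons_le_add (by decide))) _
  · exact snd_le <| size_modifyHead_le (size_cons_le_add (by decide)) _
  · exact snd_le <| size_cons_le_add (by decide) _
  · simp only [parseSymbol, size_pair, size_nil]
    omega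

namespace PolyTime

variable {α : Type} [TreeEnc α]

@[fun_prop]
theorem parse : PolyTime fun w : List Symbol => parse w ([], []) :=
  foldr (f := fun _ s st => KromImp.parseSymbol st s) id (const _) (by fun_prop) 6
    fun _ s st => by simpa using size_parseSymbol_le st s

@[fun_prop]
theorem encodeLiteral : PolyTime encodeLiteral :=
  append (map (f := fun _ => Symbol.bit) (by fun_prop) ((of_finite Symbol.bit).comp snd)) <|
    cons ((of_finite fun b => if b then Symbol.pos else Symbol.neg).comp
      (literal_positive id)) (const [])

@[fun_prop]
theorem encodeClause : PolyTime encodeClause :=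
  append (flatMap id (by fun_prop)) (const _)

@[fun_prop]
theorem encodeFormula : PolyTime encodeFormula :=
  append (flatMap id (by fun_prop)) (const _)

@[fun_prop]
theorem encodeInstance {p : α → List (List (List Literal))} {f : α → List (List Literal)}
    (hp : PolyTime p) (hf : PolyTime f) : PolyTime fun a => encodeInstance (p a) (f a) :=
  append (append (flatMap hp (by fun_prop)) (const _)) (by fun_prop)

end PolyTime

theorem polyDecidable_mem_IMP_krom : PolyDecidable fun w : List Symbol => w ∈ IMP krom := by
  simp only [mem_IMP_krom_iff]
  exact .exists_mem (by fun_prop) (by fun_prop)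

end KromImp

theorem mainTheorem10 : KromImp.InP (KromImp.IMP KromImp.krom) :=
  KromImp.inP_of_polyDecidable KromImp.polyDecidable_mem_IMP_krom
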